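/- Let $0<\alpha\le 1$ and let $\Omega\subset\mathbb R^3$ be a bounded domain (nonempty, open, connected) with $\partial\Omega\in C^{1,\alpha}$: every point of $\partial\Omega$ has a ball around it in which $\partial\Omega$ is the graph of a $C^{1,\alpha}$ function of two of the three coordinates, $\Omega$ lying strictly on one side of the graph and $\mathbb R^3\setminus\overline\Omega$ strictly on the other. Let $n_P$ be the exterior unit normal to $\partial\Omega$ at $P\in\partial\Omega$, $dS$ the surface area measure on $\partial\Omega$, $r_{PM}=|P-M|$, and let $v:\partial\Omega\to\mathbb R$ be continuous. For $M\in\mathbb R^3$ put $$u(M)=\int_{\partial\Omega}v(P)\,\frac{\partial}{\partial n_P}\Big(\frac1{r_{PM}}\Big)\,dS_P ,$$ where the normal derivative is taken with respect to $P$. Then this integral converges absolutely for every $M\in\mathbb R^3$ (including $M\in\partial\Omega$), $u$ is continuous on $\mathbb R^3\setminus\partial\Omega$, and for every $P_0\in\partial\Omega$ $$\lim_{\substack{M\to P_0\\ M\in\Omega}}u(M)=u(P_0)-2\pi v(P_0),\qquad \lim_{\substack{M\to P_0\\ M\in\mathbb R^3\setminus\overline\Omega}}u(M)=u(P_0)+2\pi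 v(P_0).$$ -/

import Mathlib

open MeasureTheory Set Filter Topology

/-- Euclidean three-space. -/
abbrev E3 : Type := EuclideanSpace ℝ (Fin 3)

/-- The Euclidean plane. -/
abbrev E2 : Type := EuclideanSpace ℝ (Fin 2)

/-- The two coordinates of `P` other than the `i`-th one. -/
def dropCoord (i : Fin 3) (P : E3) : E2 := WithLp.toLp 2 fun j => P (i.succAbove j)

/-- `f` is a `C^{1,α}` function on the open set `D`: it is differentiable there and its derivative
is Hölder continuous with exponent `α` (hence continuous). -/
def IsC1HolderOn (α : ℝ) (f : E2 → ℝ) (D : Set E2) : Prop :=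
  DifferentiableOn ℝ f D ∧
    ∃ C : ℝ, ∀ x ∈ D, ∀ y ∈ D, ‖fderiv ℝ f x - fderiv ℝ f y‖ ≤ C * ‖x - y‖ ^ α

/-- Inside the ball of radius `δ` about `P₀`, the boundary of `Ω` is the graph of the `C^{1,α}`
function `f` which expresses the `i`-th coordinate through the other two, and `Ω` lies strictly on
one side of this graph and the complement of its closure strictly on the other: `Ω` is below the
graph if `s = 1` and above it if `s = -1`. The disc on which `f` lives is the projection of the
ball. -/
structure IsBoundaryGraph (Ω : Set E3) (α : ℝ) (P₀ : E3) (δ : ℝ) (i : Fin 3) (s : ℝ)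
    (f : E2 → ℝ) : Prop where
  radius_pos : 0 < δ
  sign : s = 1 ∨ s = -1
  holder : IsC1HolderOn α f (Metric.ball (dropCoord i P₀) δ)
  boundary : ∀ P ∈ Metric.ball P₀ δ, (P ∈ frontier Ω ↔ P i - f (dropCoord i P) = 0)
  interior : ∀ P ∈ Metric.ball P₀ δ, (P ∈ Ω ↔ s * (P i - f (dropCoord i P)) < 0)
  exterior : ∀ P ∈ Metric.ball P₀ δ, (P ∉ closure Ω ↔ 0 < s * (P i - f (dropCoord i P)))

/-- `∂Ω ∈ C^{1,α}`: near each of its points the boundary is the graph of a `C^{1,α}` function of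
two of the three coordinates, with `Ω` on exactly one side. -/
def HasC1HolderBoundary (Ω : Set E3) (α : ℝ) : Prop :=
  ∀ P₀ ∈ frontier Ω, ∃ (δ : ℝ) (i : Fin 3) (s : ℝ) (f : E2 → ℝ), IsBoundaryGraph Ω α P₀ δ i s f

/-- `n` is the exterior unit normal of `Ω` at `P`: every direction making an obtuse angle with `n`
initially runs into `Ω`, every direction making an acute angle with `n` initially runs outside the
closure of `Ω`. For a boundary which is locally a graph, this is the usual normalized vector
`± (-∂₁f, -∂₂f, 1)`; see `IsBoundaryGraph.exteriorNormal_eq_graphNormal`. -/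
def IsExteriorUnitNormal (Ω : Set E3) (P n : E3) : Prop :=
  ‖n‖ = 1 ∧
    (∀ w : E3, inner ℝ w n < 0 → ∀ᶠ t : ℝ in 𝓝[>] 0, P + t • w ∈ Ω) ∧
    (∀ w : E3, 0 < inner ℝ w n → ∀ᶠ t : ℝ in 𝓝[>] 0, P + t • w ∉ closure Ω)

open Classical in
/-- The exterior unit normal `n_P` of `Ω` at `P` (and `0` at points where there is none). -/
noncomputable def exteriorNormal (Ω : Set E3) (P : E3) : E3 :=
  if h : ∃ n, IsExteriorUnitNormal Ω P n then h.choose else 0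

/-- The vector `(-∂₁f, -∂₂f, 1)` at `P`, the entry `1` standing in the `i`-th place. -/
noncomputable def graphVector (i : Fin 3) (f : E2 → ℝ) (P : E3) : E3 :=
  EuclideanSpace.single i 1 - ∑ j : Fin 2,
    (fderiv ℝ f (dropCoord i P) (EuclideanSpace.single j 1)) •
      EuclideanSpace.single (i.succAbove j) 1

/-- The area measure `dS` on `∂Ω`: two-dimensional Hausdorff measure, normalized so that it is
Lebesgue measure on planes. -/
noncomputable def surfaceMeasure (Ω : Set E3) : Measure E3 :=
  (Measure.euclideanHausdorffMeasure 2 : Measure E3).restrict (frontier Ω)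

/-- The kernel `∂(1/r_{PM})/∂n_P`: the derivative of `Q ↦ 1/|Q - M|` at `Q = P` in the direction of
the exterior unit normal `n_P`. -/
noncomputable def doubleLayerKernel (Ω : Set E3) (M P : E3) : ℝ :=
  lineDeriv ℝ (fun Q : E3 => 1 / dist Q M) P (exteriorNormal Ω P)

/-- The double-layer potential `u(M) = ∫_{∂Ω} v(P) ∂(1/r_{PM})/∂n_P dS_P`, for every `M` in space,
on and off `∂Ω`. -/
noncomputable def doubleLayerPotential (Ω : Set E3) (v : E3 → ℝ) (M : E3) : ℝ :=
  ∫ P, v P * doubleLayerKernel Ω M P ∂(surfaceMeasure Ω)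

theorem IsExteriorUnitNormal.unique {Ω : Set E3} {P n m : E3}
    (hn : IsExteriorUnitNormal Ω P n) (hm : IsExteriorUnitNormal Ω P m) : n = m := by
  by_contra hne
  have hlt : inner ℝ n m < (1 : ℝ) := (inner_lt_one_iff_real_of_norm_eq_one hn.1 hm.1).2 hne
  have h1 : 0 < inner ℝ (n - m) n := by
    rw [inner_sub_left, real_inner_self_eq_norm_sq, hn.1, real_inner_comm]; linarith
  have h2 : inner ℝ (n - m) m < 0 := by
    rw [inner_sub_left, real_inner_self_eq_norm_sq, hm.1]; linarith
  obtain ⟨t, ht, ht'⟩ := ((hn.2.2 _ h1).and (hm.2.1 _ h2)).exists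
  exact ht (subset_closure ht')

theorem IsExteriorUnitNormal.exteriorNormal_eq {Ω : Set E3} {P n : E3}
    (hn : IsExteriorUnitNormal Ω P n) : exteriorNormal Ω P = n := by
  have h : ∃ n, IsExteriorUnitNormal Ω P n := ⟨n, hn⟩
  rw [exteriorNormal, dif_pos h]
  exact h.choose_spec.unique hn

theorem inner_graphVector (i : Fin 3) (f : E2 → ℝ) (P w : E3) :
    inner ℝ w (graphVector i f P) =
      w i - fderiv ℝ f (dropCoord i P) (dropCoord i w) := by
  have hw : dropCoord i w = ∑ j : Fin 2, w (i.succAbove j) • EuclideanSpace.single j (1 : ℝ) := by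
    ext k
    fin_cases k <;> simp [dropCoord]
  rw [hw, map_sum, graphVector, inner_sub_right, inner_sum]
  simp [inner_smul_right, EuclideanSpace.inner_single_right, mul_comm]

/-- Where the boundary is a graph, the exterior unit normal exists and is the classical one. -/
theorem IsBoundaryGraph.isExteriorUnitNormal {Ω : Set E3} {α : ℝ} {P₀ : E3} {δ : ℝ} {i : Fin 3}
    {s : ℝ} {f : E2 → ℝ} (h : IsBoundaryGraph Ω α P₀ δ i s f) {P : E3}
    (hP : P ∈ frontier Ω) (hPδ : P ∈ Metric.ball P₀ δ) :
    IsExteriorUnitNormal Ω P ((s / ‖graphVector i f P‖) • graphVector i f P) := by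
  have hN : graphVector i f P ≠ 0 := by
    intro h0
    have h1 := inner_graphVector i f P (EuclideanSpace.single i 1)
    have h2 : dropCoord i (EuclideanSpace.single i (1 : ℝ)) = 0 := by
      ext j
      simp [dropCoord]
    rw [h0, h2] at h1
    simp at h1
  have hNpos : 0 < ‖graphVector i f P‖ := norm_pos_iff.2 hN
  have hdrop : dropCoord i P ∈ Metric.ball (dropCoord i P₀) δ := by
    rw [Metric.mem_ball] at hPδ ⊢
    refine lt_of_le_of_lt ?_ hPδ
    rw [EuclideanSpace.dist_eq, EuclideanSpace.dist_eq]
    apply Real.sqrt_le_sqrt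
    rw [Fin.sum_univ_succAbove _ i]
    simp only [dropCoord]
    have := sq_nonneg (dist (P i) (P₀ i))
    linarith
  have hf : HasFDerivAt f (fderiv ℝ f (dropCoord i P)) (dropCoord i P) :=
    (h.holder.1.differentiableAt (Metric.isOpen_ball.mem_nhds hdrop)).hasFDerivAt
  have hlin (w : E3) (t : ℝ) : dropCoord i (P + t • w) = dropCoord i P + t • dropCoord i w := by
    ext j
    simp [dropCoord]
  have hder (w : E3) : HasDerivAt (fun t : ℝ => s * ((P + t • w) i - f (dropCoord i (P + t • w))))
      (s * inner ℝ w (graphVector i f P)) 0 := by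
    rw [inner_graphVector]
    have hl : HasDerivAt (fun t : ℝ => dropCoord i P + t • dropCoord i w) (dropCoord i w) 0 := by
      simpa using ((hasDerivAt_id (0 : ℝ)).smul_const (dropCoord i w)).const_add (dropCoord i P)
    have hf' : HasFDerivAt f (fderiv ℝ f (dropCoord i P))
        (dropCoord i P + (0 : ℝ) • dropCoord i w) := by simpa using hf
    have hc : HasDerivAt (fun t : ℝ => (P + t • w) i) (w i) 0 := by
      simpa using ((hasDerivAt_id (0 : ℝ)).mul_const (w i)).const_add (P i)
    have := (hc.sub (hf'.comp_hasDerivAt (0 : ℝ) hl)).const_mul s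
    refine this.congr_of_eventuallyEq (Eventually.of_forall fun t => ?_)
    simp [hlin]
  have hzero : P i - f (dropCoord i P) = 0 := (h.boundary P hPδ).1 hP
  have hball (w : E3) : ∀ᶠ t : ℝ in 𝓝[>] 0, P + t • w ∈ Metric.ball P₀ δ := by
    have hc : ContinuousAt (fun t : ℝ => P + t • w) 0 := by fun_prop
    refine (hc.eventually_mem (Metric.isOpen_ball.mem_nhds ?_)).filter_mono nhdsWithin_le_nhds
    simpa using hPδ
  have hinner (w : E3) : inner ℝ w ((s / ‖graphVector i f P‖) • graphVector i f P) =
      (s * inner ℝ w (graphVector i f P)) / ‖graphVector i f P‖ := by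
    rw [inner_smul_right]; ring
  refine ⟨?_, fun w hw => ?_, fun w hw => ?_⟩
  · rw [norm_smul, norm_div, norm_norm]
    rcases h.sign with hs | hs <;> simp [hs, hNpos.ne']
  · rw [hinner, div_lt_iff₀ hNpos, zero_mul] at hw
    have hs := (hasDerivWithinAt_iff_tendsto_slope' (s := Ioi (0 : ℝ)) (by simp)).1
      (hder w).hasDerivWithinAt
    filter_upwards [hs.eventually (gt_mem_nhds hw), hball w, self_mem_nhdsWithin] with t ht hb h0
    rw [h.interior _ hb]
    simp only [slope_def_field, zero_smul, add_zero, hzero, mul_zero, sub_zero] at ht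
    rw [div_lt_iff₀ h0, zero_mul] at ht
    exact ht
  · rw [hinner, lt_div_iff₀ hNpos, zero_mul] at hw
    have hs := (hasDerivWithinAt_iff_tendsto_slope' (s := Ioi (0 : ℝ)) (by simp)).1
      (hder w).hasDerivWithinAt
    filter_upwards [hs.eventually (lt_mem_nhds hw), hball w, self_mem_nhdsWithin] with t ht hb h0
    rw [h.exterior _ hb]
    simp only [slope_def_field, zero_smul, add_zero, hzero, mul_zero, sub_zero] at ht
    rw [lt_div_iff₀ h0, zero_mul] at ht
    exact ht

theorem IsBoundaryGraph.exteriorNormal_eq_graphNormal {Ω : Set E3} {α : ℝ} {P₀ : E3} {δ : ℝ}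
    {i : Fin 3} {s : ℝ} {f : E2 → ℝ} (h : IsBoundaryGraph Ω α P₀ δ i s f) {P : E3}
    (hP : P ∈ frontier Ω) (hPδ : P ∈ Metric.ball P₀ δ) :
    exteriorNormal Ω P = (s / ‖graphVector i f P‖) • graphVector i f P :=
  (h.isExteriorUnitNormal hP hPδ).exteriorNormal_eq

/-! The question is local at `P₀`. Where the boundary is the graph of `f`, the area formula turns
`dS` into `areaElement f` times Lebesgue measure on a disc. The length of the graph normal equals
this factor and cancels it, so up to sign the kernel becomes `graphKernel`, a solid angle density on
the plane. Two facts about it carry the proof.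

First, its `L¹` norm over the disc is bounded uniformly in the pole
(`exists_integral_abs_graphKernel_le`). Let `h` be the height of the graph relative to the pole,
measured on the vertical line through the pole, and `ρ` the horizontal distance. The numerator is
`h` minus a Taylor remainder of size `ρ ^ (1 + α)`. Hence the kernel is at most a multiple of `|h| /
(ρ² + h²) ^ (3/2)`, whose integral over the plane is the same for all `h ≠ 0`, plus a multiple of
the locally integrable `ρ ^ (α - 2)`.

Second, in polar coordinates about the projection of the pole the kernel is an exact radial
derivative. Its integral over a disc is therefore `2π` times a sign minus a rim term
(`integral_graphKernel_ball`); for a pole on the graph the inner boundary term is odd in the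
direction and integrates to zero. The rim term and the integral outside the disc vary continuously
with the pole, even across the graph, so the sign is the only discontinuity. This is the jump for
constant density.

For general `v`, split `v = (v - v P₀) + v P₀` on a patch around `P₀`. By the uniform bound the
first summand contributes a function continuous at `P₀` (`continuousAt_integral_of_eq_zero`), the
second one jumps by `2π v P₀`, and the part of the boundary off the patch stays at positive
distance. -/

open scoped ENNReal NNReal Real

/-! ### Comparison and localization of measures -/

/-- If `h` expands distances on `s` at least as much as `g / K`, then the image of `s` under `g` has
at most `K ^ d` times the `d`-dimensional Hausdorff measure of the image under `h`. -/
theorem euclideanHausdorffMeasure_image_le_of_dist_le {W X Y : Type*} [MetricSpace X]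
    [MeasurableSpace X] [BorelSpace X] [MetricSpace Y] [MeasurableSpace Y] [BorelSpace Y]
    {g : W → X} {h : W → Y} {s : Set W} {K : ℝ≥0} (d : ℕ)
    (hgh : ∀ x ∈ s, ∀ y ∈ s, dist (g x) (g y) ≤ K * dist (h x) (h y)) :
    (Measure.euclideanHausdorffMeasure d : Measure X) (g '' s) ≤
      (K : ℝ≥0∞) ^ d * (Measure.euclideanHausdorffMeasure d : Measure Y) (h '' s) := by
  rcases s.eq_empty_or_nonempty with rfl | ⟨x₀, hx₀⟩
  · simp
  have : Nonempty W := ⟨x₀⟩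
  -- This is `g ∘ h⁻¹`: by hypothesis points with the same image under `h` have the same image under
  -- `g`, so the choice of preimage is immaterial and the map is `K`-Lipschitz on `h '' s`.
  set φ : Y → X := fun y => g (Function.invFunOn h s y) with hφ
  have hinv : ∀ x ∈ s, Function.invFunOn h s (h x) ∈ s ∧ h (Function.invFunOn h s (h x)) = h x :=
    fun x hx => ⟨Function.invFunOn_mem ⟨x, hx, rfl⟩, Function.invFunOn_eq ⟨x, hx, rfl⟩⟩
  have hφg : ∀ x ∈ s, φ (h x) = g x := by
    intro x hx
    have := hgh _ (hinv x hx).1 x hx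
    rw [(hinv x hx).2, dist_self, mul_zero] at this
    exact dist_le_zero.1 this
  have himage : φ '' (h '' s) = g '' s := by
    rw [image_image]
    exact image_congr hφg
  have hlip : LipschitzOnWith K φ (h '' s) := by
    refine LipschitzOnWith.of_dist_le_mul ?_
    rintro _ ⟨x, hx, rfl⟩ _ ⟨y, hy, rfl⟩
    rw [hφg x hx, hφg y hy]
    exact hgh x hx y hy
  have := hlip.hausdorffMeasure_image_le (d := d) (by positivity)
  rw [himage, ENNReal.rpow_natCast] at this
  simp only [Measure.euclideanHausdorffMeasure_def, Measure.smul_apply]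
  rw [mul_smul_comm]
  gcongr

/-- An inequality between measures which holds locally on `U` holds on all of `U`. -/
theorem measure_le_of_locally_le {X : Type*} [TopologicalSpace X] [SecondCountableTopology X]
    [MeasurableSpace X] [OpensMeasurableSpace X] {μ ν : Measure X} {U : Set X}
    (h : ∀ x ∈ U, ∃ W : Set X, IsOpen W ∧ x ∈ W ∧
      ∀ A ⊆ W, A ⊆ U → MeasurableSet A → μ A ≤ ν A)
    {A : Set X} (hA : MeasurableSet A) (hAU : A ⊆ U) : μ A ≤ ν A := by
  choose! W hWo hxW hW using h
  obtain ⟨t, htU, htc, hcover⟩ := TopologicalSpace.countable_cover_nhdsWithin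
    (s := U) (f := W) fun x hx => mem_nhdsWithin_of_mem_nhds ((hWo x hx).mem_nhds (hxW x hx))
  rcases t.eq_empty_or_nonempty with rfl | hne
  · have : A = ∅ := by simpa using hAU.trans hcover
    simp [this]
  obtain ⟨e, rfl⟩ := htc.exists_eq_range hne
  rw [biUnion_range] at hcover
  have hWm : ∀ n, MeasurableSet (W (e n)) := fun n => (hWo _ (htU ⟨n, rfl⟩)).measurableSet
  have hpart : A = ⋃ n, A ∩ disjointed (fun n => W (e n)) n := by
    rw [← inter_iUnion, iUnion_disjointed, inter_eq_left.2 (hAU.trans hcover)]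
  have hm : ∀ n, MeasurableSet (A ∩ disjointed (fun n => W (e n)) n) :=
    fun n => hA.inter (MeasurableSet.disjointed hWm n)
  have hd : Pairwise (Function.onFun Disjoint fun n => A ∩ disjointed (fun n => W (e n)) n) :=
    fun i j hij => ((disjoint_disjointed _) hij).mono inter_subset_right inter_subset_right
  rw [hpart, measure_iUnion hd hm, measure_iUnion hd hm]
  refine ENNReal.tsum_le_tsum fun n => hW (e n) (htU ⟨n, rfl⟩) _ ?_ ?_ (hm n)
  · exact inter_subset_right.trans (disjointed_subset _ _)
  · exact inter_subset_left.trans hAU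

/-! ### The area formula for `C¹` graphs -/

/-- The area element `√(1 + |∇f|²)` of the graph of `f`. -/
noncomputable def areaElement (f : E2 → ℝ) (x : E2) : ℝ := √(1 + ‖fderiv ℝ f x‖ ^ 2)

theorem one_le_areaElement (f : E2 → ℝ) (x : E2) : 1 ≤ areaElement f x := by
  rw [areaElement, Real.one_le_sqrt]
  nlinarith [sq_nonneg ‖fderiv ℝ f x‖]

theorem measurable_areaElement (f : E2 → ℝ) : Measurable (areaElement f) := by
  unfold areaElement
  have := measurable_fderiv ℝ f
  fun_prop

/-- A linear functional `ℓ` on an inner product space has a linear square root `T` of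
`|y|² + (ℓ y)²`, of determinant `√(1 + |ℓ|²)`. -/
theorem exists_norm_sq_eq_add_sq {E : Type*} [NormedAddCommGroup E] [InnerProductSpace ℝ E]
    [FiniteDimensional ℝ E] (ℓ : E →L[ℝ] ℝ) :
    ∃ T : E →L[ℝ] E, (∀ y, ‖T y‖ ^ 2 = ‖y‖ ^ 2 + ℓ y ^ 2) ∧ T.det = √(1 + ‖ℓ‖ ^ 2) := by
  set m := ‖ℓ‖ with hm
  set q := √(1 + m ^ 2) with hq
  have hq2 : q ^ 2 = 1 + m ^ 2 := Real.sq_sqrt (by positivity)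
  have hq0 : 0 ≤ q := Real.sqrt_nonneg _
  -- Try `T y = y + c (ℓ y) a` with `a` representing `ℓ`. The norm identity amounts to `c² m² + 2 c
  -- = 1`, whose positive root is this `c`; then the determinant is `1 + c m² = q`.
  set c := 1 / (1 + q) with hc
  set a := (InnerProductSpace.toDual ℝ E).symm ℓ with ha
  have hay (y : E) : inner ℝ a y = ℓ y := InnerProductSpace.toDual_symm_apply
  have ham : ‖a‖ = m := by simp [ha, hm]
  have haa : ℓ a = m ^ 2 := by rw [← hay, real_inner_self_eq_norm_sq, ham]
  refine ⟨LinearMap.toContinuousLinearMap (LinearMap.transvection (ℓ : E →ₗ[ℝ] ℝ) (c • a)), ?_, ?_⟩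
  · intro y
    have hT : LinearMap.toContinuousLinearMap
        (LinearMap.transvection (ℓ : E →ₗ[ℝ] ℝ) (c • a)) y = y + (ℓ y * c) • a := by
      simp [LinearMap.transvection.apply, smul_smul]
    rw [hT, norm_add_sq_real, inner_smul_right, real_inner_comm, hay, norm_smul, mul_pow, ham,
      Real.norm_eq_abs, sq_abs]
    have : c ^ 2 * m ^ 2 + 2 * c = 1 := by
      rw [hc]
      field_simp
      nlinarith
    linear_combination ℓ y ^ 2 * this
  · rw [ContinuousLinearMap.det, LinearMap.coe_toContinuousLinearMap,
      LinearMap.transvection.det]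
    simp only [ContinuousLinearMap.coe_coe, map_smul, haa, smul_eq_mul]
    rw [hc]
    field_simp
    nlinarith

theorem norm_sq_eq_sq_add_norm_sq (i : Fin 3) (P : E3) :
    ‖P‖ ^ 2 = P i ^ 2 + ‖dropCoord i P‖ ^ 2 := by
  rw [EuclideanSpace.norm_sq_eq, EuclideanSpace.norm_sq_eq, Fin.sum_univ_succAbove _ i]
  simp [dropCoord]

theorem dropCoord_sub (i : Fin 3) (P Q : E3) :
    dropCoord i (P - Q) = dropCoord i P - dropCoord i Q := by
  ext j
  simp [dropCoord]

theorem norm_dropCoord_le (i : Fin 3) (P : E3) : ‖dropCoord i P‖ ≤ ‖P‖ := by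
  have := norm_sq_eq_sq_add_norm_sq i P
  exact le_of_sq_le_sq (by nlinarith [sq_nonneg (P i)]) (norm_nonneg _)

theorem continuous_dropCoord (i : Fin 3) : Continuous (dropCoord i) := by
  unfold dropCoord
  fun_prop

/-- The point of the graph of `f` over `x`, the `i`-th coordinate being the dependent one. -/
def graphMap (i : Fin 3) (f : E2 → ℝ) (x : E2) : E3 :=
  WithLp.toLp 2 (Fin.insertNth (α := fun _ => ℝ) i (f x) (fun j => x j))

@[simp] theorem graphMap_apply_self (i : Fin 3) (f : E2 → ℝ) (x : E2) :
    graphMap i f x i = f x := by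
  simp [graphMap]

@[simp] theorem dropCoord_graphMap (i : Fin 3) (f : E2 → ℝ) (x : E2) :
    dropCoord i (graphMap i f x) = x := by
  ext j
  simp [graphMap, dropCoord]

theorem eq_graphMap_iff {i : Fin 3} {f : E2 → ℝ} {P : E3} :
    P = graphMap i f (dropCoord i P) ↔ P i = f (dropCoord i P) := by
  refine ⟨fun h => ?_, fun h => ?_⟩
  · conv_lhs => rw [h]
    simp
  · ext j
    rcases Fin.eq_self_or_eq_succAbove i j with rfl | ⟨k, rfl⟩
    · simp [h]
    · simp [graphMap, dropCoord]

theorem graphMap_injective (i : Fin 3) (f : E2 → ℝ) : Function.Injective (graphMap i f) :=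
  Function.LeftInverse.injective (dropCoord_graphMap i f)

theorem measurable_graphMap (i : Fin 3) {f : E2 → ℝ} (hf : Measurable f) :
    Measurable (graphMap i f) := by
  refine (WithLp.measurable_toLp 2 _).comp (measurable_pi_lambda _ fun j => ?_)
  rcases Fin.eq_self_or_eq_succAbove i j with rfl | ⟨k, rfl⟩
  · simpa using hf
  · simp only [Fin.insertNth_apply_succAbove]
    fun_prop

theorem measurableEmbedding_graphMap (i : Fin 3) {f : E2 → ℝ} (hf : Measurable f) :
    MeasurableEmbedding (graphMap i f) :=
  (measurable_graphMap i hf).measurableEmbedding (graphMap_injective i f)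

theorem dist_graphMap_sq (i : Fin 3) (f : E2 → ℝ) (x y : E2) :
    dist (graphMap i f x) (graphMap i f y) ^ 2 = ‖x - y‖ ^ 2 + (f x - f y) ^ 2 := by
  rw [dist_eq_norm, norm_sq_eq_sq_add_norm_sq i, dropCoord_sub]
  simp [add_comm]

/-- The triangle inequality in the plane for `(a, b) = (a, c) + (0, b - c)`. -/
theorem sqrt_sq_add_sq_le {a b c : ℝ} : √(a ^ 2 + b ^ 2) ≤ √(a ^ 2 + c ^ 2) + |b - c| := by
  have h0 : 0 ≤ √(a ^ 2 + c ^ 2) := Real.sqrt_nonneg _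
  have h1 : |c| ≤ √(a ^ 2 + c ^ 2) := by
    apply Real.le_sqrt_of_sq_le
    rw [sq_abs]
    nlinarith [sq_nonneg a]
  have h2 : √(a ^ 2 + c ^ 2) ^ 2 = a ^ 2 + c ^ 2 := Real.sq_sqrt (by positivity)
  rw [Real.sqrt_le_left (by positivity)]
  have h3 : (b - c) * c ≤ |b - c| * √(a ^ 2 + c ^ 2) := by
    calc (b - c) * c ≤ |b - c| * |c| := by rw [← abs_mul]; exact le_abs_self _
      _ ≤ _ := by gcongr
  nlinarith [sq_abs (b - c)]

/-- Near a point, the graph of a `C¹` function is metrically close to a linear image of the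
plane. -/
theorem exists_isOpen_graphMap_almost_linear {f : E2 → ℝ} {U : Set E2} (hU : IsOpen U)
    (hf : DifferentiableOn ℝ f U) (hf' : ContinuousOn (fderiv ℝ f) U) (i : Fin 3) {x : E2}
    (hx : x ∈ U) {T : E2 →L[ℝ] E2} (hT : ∀ y, ‖T y‖ ^ 2 = ‖y‖ ^ 2 + fderiv ℝ f x y ^ 2)
    {ε : ℝ} (hε : 0 < ε) :
    ∃ W : Set E2, IsOpen W ∧ x ∈ W ∧ ∀ y ∈ W, ∀ z ∈ W,
      dist (graphMap i f y) (graphMap i f z) ≤ (1 + ε) * dist (T y) (T z) ∧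
      dist (T y) (T z) ≤ (1 + ε) * dist (graphMap i f y) (graphMap i f z) := by
  have hnear : ∀ᶠ y in 𝓝 x, ‖fderiv ℝ f y - fderiv ℝ f x‖ < ε := by
    have := (hf'.continuousAt (hU.mem_nhds hx)).tendsto
    simpa [dist_eq_norm] using this.eventually (Metric.ball_mem_nhds _ hε)
  obtain ⟨ρ, hρ, hball⟩ := Metric.eventually_nhds_iff_ball.1 (hnear.and (hU.mem_nhds hx))
  refine ⟨Metric.ball x ρ, Metric.isOpen_ball, Metric.mem_ball_self hρ, fun y hy z hz => ?_⟩
  -- The mean value inequality for `f` minus its linear part at `x`; this error is all that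
  -- distinguishes the distance on the graph from the distance after applying `T`.
  have hmv : ‖f y - f z - fderiv ℝ f x (y - z)‖ ≤ ε * ‖y - z‖ :=
    (convex_ball x ρ).norm_image_sub_le_of_norm_fderiv_le'
      (fun w hw => hf.differentiableAt (hU.mem_nhds (hball w hw).2))
      (fun w hw => (hball w hw).1.le) hz hy
  have h1 : dist (graphMap i f y) (graphMap i f z) = √(‖y - z‖ ^ 2 + (f y - f z) ^ 2) := by
    rw [← dist_graphMap_sq i, Real.sqrt_sq dist_nonneg]
  have h2 : dist (T y) (T z) = √(‖y - z‖ ^ 2 + (fderiv ℝ f x (y - z)) ^ 2) := by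
    rw [dist_eq_norm, ← map_sub, ← hT, Real.sqrt_sq (norm_nonneg _)]
  have h3 (b : ℝ) : ‖y - z‖ ≤ √(‖y - z‖ ^ 2 + b ^ 2) :=
    Real.le_sqrt_of_sq_le (by nlinarith [sq_nonneg b])
  rw [Real.norm_eq_abs] at hmv
  constructor
  · rw [h1, h2]
    refine (sqrt_sq_add_sq_le (c := fderiv ℝ f x (y - z))).trans ?_
    nlinarith [h3 (fderiv ℝ f x (y - z))]
  · rw [h1, h2]
    refine (sqrt_sq_add_sq_le (c := f y - f z)).trans ?_
    rw [abs_sub_comm]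
    nlinarith [h3 (f y - f z)]

theorem continuousOn_areaElement {f : E2 → ℝ} {U : Set E2} (hf' : ContinuousOn (fderiv ℝ f) U) :
    ContinuousOn (areaElement f) U := by
  unfold areaElement
  fun_prop

/-- Two-sided comparison of the area of a small piece of a graph with the integral of the area
element. -/
theorem exists_isOpen_area_almost_eq {f : E2 → ℝ} {U : Set E2} (hU : IsOpen U)
    (hf : DifferentiableOn ℝ f U) (hf' : ContinuousOn (fderiv ℝ f) U) (i : Fin 3) {x : E2}
    (hx : x ∈ U) {K : ℝ≥0} (hK : 1 < K) :
    ∃ W : Set E2, IsOpen W ∧ x ∈ W ∧ ∀ A ⊆ W, MeasurableSet A →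
      (Measure.euclideanHausdorffMeasure 2 : Measure E3) (graphMap i f '' A) ≤
        (K : ℝ≥0∞) ^ 3 * ∫⁻ y in A, ENNReal.ofReal (areaElement f y) ∧
      ∫⁻ y in A, ENNReal.ofReal (areaElement f y) ≤ (K : ℝ≥0∞) ^ 3 *
        (Measure.euclideanHausdorffMeasure 2 : Measure E3) (graphMap i f '' A) := by
  obtain ⟨T, hT, hdet⟩ := exists_norm_sq_eq_add_sq (fderiv ℝ f x)
  obtain ⟨W, hWo, hxW, hW⟩ := exists_isOpen_graphMap_almost_linear hU hf hf' i hx hT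
    (ε := (K : ℝ) - 1) (sub_pos.2 (by exact_mod_cast hK))
  simp only [add_sub_cancel] at hW
  set J := areaElement f x with hJ
  have hJ1 : 1 ≤ J := one_le_areaElement f x
  have hKr : (1 : ℝ) < K := by exact_mod_cast hK
  have hcont := (continuousOn_areaElement hf').continuousAt (hU.mem_nhds hx)
  have hev : ∀ᶠ y in 𝓝 x, areaElement f y < K * J ∧ J < K * areaElement f y := by
    refine (hcont.eventually (gt_mem_nhds (by nlinarith))).and ?_
    exact (hcont.const_mul (K : ℝ)).eventually (lt_mem_nhds (by nlinarith))
  obtain ⟨V, hV, hVo, hxV⟩ := eventually_nhds_iff.1 hev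
  refine ⟨W ∩ V, hWo.inter hVo, ⟨hxW, hxV⟩, fun A hA hAm => ?_⟩
  have hTA : (Measure.euclideanHausdorffMeasure 2 : Measure E2) (T '' A) =
      ENNReal.ofReal J * volume A := by
    rw [EuclideanSpace.euclideanHausdorffMeasure_eq_volume, Measure.addHaar_image_continuousLinearMap,
      show LinearMap.det (T : E2 →ₗ[ℝ] E2) = _ from hdet, abs_of_nonneg (Real.sqrt_nonneg _), hJ,
      areaElement]
  have hup := euclideanHausdorffMeasure_image_le_of_dist_le 2 (s := A) (K := K)
    (g := graphMap i f) (h := T) fun y hy z hz => (hW y (hA hy).1 z (hA hz).1).1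
  have hlo := euclideanHausdorffMeasure_image_le_of_dist_le 2 (s := A) (K := K)
    (g := T) (h := graphMap i f) fun y hy z hz => (hW y (hA hy).1 z (hA hz).1).2
  rw [hTA] at hup hlo
  have hi1 : ENNReal.ofReal J * volume A ≤ K * ∫⁻ y in A, ENNReal.ofReal (areaElement f y) := by
    rw [← setLIntegral_const, ← lintegral_const_mul _ (measurable_areaElement f).ennreal_ofReal]
    refine setLIntegral_mono' hAm fun y hy => ?_
    rw [← ENNReal.ofReal_coe_nnreal, ← ENNReal.ofReal_mul K.coe_nonneg]
    exact ENNReal.ofReal_le_ofReal (hV y (hA hy).2).2.le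
  have hi2 : ∫⁻ y in A, ENNReal.ofReal (areaElement f y) ≤ K * (ENNReal.ofReal J * volume A) := by
    rw [← mul_assoc, ← setLIntegral_const]
    refine setLIntegral_mono' hAm fun y hy => ?_
    rw [← ENNReal.ofReal_coe_nnreal, ← ENNReal.ofReal_mul K.coe_nonneg]
    exact ENNReal.ofReal_le_ofReal (hV y (hA hy).2).1.le
  -- Of the three factors `K`, two come from the Lipschitz comparison in dimension two and one from
  -- the oscillation of the area element.
  constructor
  · calc _ ≤ (K : ℝ≥0∞) ^ 2 * (ENNReal.ofReal J * volume A) := hup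
      _ ≤ (K : ℝ≥0∞) ^ 2 * (K * ∫⁻ y in A, ENNReal.ofReal (areaElement f y)) := by gcongr
      _ = _ := by ring
  · calc _ ≤ K * (ENNReal.ofReal J * volume A) := hi2
      _ ≤ K * ((K : ℝ≥0∞) ^ 2 * (Measure.euclideanHausdorffMeasure 2 : Measure E3)
          (graphMap i f '' A)) := by gcongr
      _ = _ := by ring

/-- Let `K` decrease to `1`. The multiplicative form needs no finiteness of `b`, since the limit of
`K ^ n` is not zero. -/
theorem ENNReal.le_of_forall_le_pow_mul {a b : ℝ≥0∞} (n : ℕ)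
    (h : ∀ K : ℝ≥0, 1 < K → a ≤ (K : ℝ≥0∞) ^ n * b) : a ≤ b := by
  have ht : Tendsto (fun K : ℝ≥0 => (K : ℝ≥0∞) ^ n * b) (𝓝[>] 1) (𝓝 ((1 : ℝ≥0∞) ^ n * b)) := by
    refine ENNReal.Tendsto.mul_const ?_ (Or.inl (by simp))
    have : Continuous fun K : ℝ≥0 => (K : ℝ≥0∞) ^ n := by fun_prop
    simpa using (this.tendsto 1).mono_left nhdsWithin_le_nhds
  rw [one_pow, one_mul] at ht
  exact ge_of_tendsto ht (by filter_upwards [self_mem_nhdsWithin] with K hK using h K hK)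

/-- The area formula for graphs. -/
theorem euclideanHausdorffMeasure_graphMap_image {f : E2 → ℝ} (hfm : Measurable f) {U : Set E2}
    (hU : IsOpen U) (hf : DifferentiableOn ℝ f U) (hf' : ContinuousOn (fderiv ℝ f) U) (i : Fin 3)
    {A : Set E2} (hA : MeasurableSet A) (hAU : A ⊆ U) :
    (Measure.euclideanHausdorffMeasure 2 : Measure E3) (graphMap i f '' A) =
      ∫⁻ x in A, ENNReal.ofReal (areaElement f x) := by
  have hemb := measurableEmbedding_graphMap i hfm
  set ν : Measure E2 := (Measure.euclideanHausdorffMeasure 2 : Measure E3).comap (graphMap i f)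
  set l : Measure E2 := volume.withDensity fun x => ENNReal.ofReal (areaElement f x)
  have hν (B : Set E2) : ν B =
      (Measure.euclideanHausdorffMeasure 2 : Measure E3) (graphMap i f '' B) := hemb.comap_apply _ _
  have hl {B : Set E2} (hB : MeasurableSet B) : l B =
      ∫⁻ x in B, ENNReal.ofReal (areaElement f x) := withDensity_apply _ hB
  rw [← hν, ← hl hA]
  -- The local comparison with constant `K ^ 3` globalizes, because a countable cover can be made
  -- disjoint; then `K → 1`.
  apply le_antisymm <;> refine ENNReal.le_of_forall_le_pow_mul 3 fun K hK => ?_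
  · refine measure_le_of_locally_le (ν := ((K : ℝ≥0∞) ^ 3) • l) (fun x hx => ?_) hA hAU
    obtain ⟨W, hWo, hxW, hW⟩ := exists_isOpen_area_almost_eq hU hf hf' i hx hK
    refine ⟨W, hWo, hxW, fun B hB _ hBm => ?_⟩
    rw [Measure.smul_apply, hν, hl hBm]
    exact (hW B hB hBm).1
  · refine measure_le_of_locally_le (ν := ((K : ℝ≥0∞) ^ 3) • ν) (fun x hx => ?_) hA hAU
    obtain ⟨W, hWo, hxW, hW⟩ := exists_isOpen_area_almost_eq hU hf hf' i hx hK
    refine ⟨W, hWo, hxW, fun B hB _ hBm => ?_⟩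
    rw [Measure.smul_apply, hν, hl hBm]
    exact (hW B hB hBm).2

/-- The area measure on a graph is the image of the area element. -/
theorem euclideanHausdorffMeasure_restrict_graph {f : E2 → ℝ} (hfm : Measurable f) {U : Set E2}
    (hU : IsOpen U) (hf : DifferentiableOn ℝ f U) (hf' : ContinuousOn (fderiv ℝ f) U) (i : Fin 3) :
    (Measure.euclideanHausdorffMeasure 2 : Measure E3).restrict (graphMap i f '' U) =
      ((volume.restrict U).withDensity fun x => ENNReal.ofReal (areaElement f x)).map
        (graphMap i f) := by
  have hemb := measurableEmbedding_graphMap i hfm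
  ext B hB
  rw [hemb.map_apply, Measure.restrict_apply hB, withDensity_apply _ (hemb.measurable hB),
    Measure.restrict_restrict (hemb.measurable hB), ← euclideanHausdorffMeasure_graphMap_image hfm hU
      hf hf' i ((hemb.measurable hB).inter hU.measurableSet) inter_subset_right,
    image_preimage_inter]

theorem integrableOn_graph_iff {f : E2 → ℝ} (hfm : Measurable f) {U : Set E2}
    (hU : IsOpen U) (hf : DifferentiableOn ℝ f U) (hf' : ContinuousOn (fderiv ℝ f) U) (i : Fin 3)
    (F : E3 → ℝ) :
    IntegrableOn F (graphMap i f '' U) (Measure.euclideanHausdorffMeasure 2) ↔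
      IntegrableOn (fun x => areaElement f x * F (graphMap i f x)) U := by
  rw [IntegrableOn, euclideanHausdorffMeasure_restrict_graph hfm hU hf hf' i,
    (measurableEmbedding_graphMap i hfm).integrable_map_iff,
    integrable_withDensity_iff_integrable_smul' (measurable_areaElement f).ennreal_ofReal (by simp),
    IntegrableOn]
  refine integrable_congr (ae_of_all _ fun x => ?_)
  simp [ENNReal.toReal_ofReal (zero_le_one.trans (one_le_areaElement f x))]

theorem setIntegral_graph {f : E2 → ℝ} (hfm : Measurable f) {U : Set E2}
    (hU : IsOpen U) (hf : DifferentiableOn ℝ f U) (hf' : ContinuousOn (fderiv ℝ f) U) (i : Fin 3)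
    (F : E3 → ℝ) :
    ∫ P in graphMap i f '' U, F P ∂(Measure.euclideanHausdorffMeasure 2) =
      ∫ x in U, areaElement f x * F (graphMap i f x) := by
  rw [euclideanHausdorffMeasure_restrict_graph hfm hU hf hf' i,
    (measurableEmbedding_graphMap i hfm).integral_map,
    integral_withDensity_eq_integral_toReal_smul (measurable_areaElement f).ennreal_ofReal (by simp)]
  simp [ENNReal.toReal_ofReal (zero_le_one.trans (one_le_areaElement f _))]

/-! ### Uniform integrability of the solid angle kernel -/

/-- The solid angle density at `(m, t)` of the graph of `f` over the plane. -/
noncomputable def graphKernel (f : E2 → ℝ) (m : E2) (t : ℝ) (x : E2) : ℝ :=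
  (f x - t - fderiv ℝ f x (x - m)) / √(‖x - m‖ ^ 2 + (f x - t) ^ 2) ^ 3

theorem measurable_graphKernel {f : E2 → ℝ} (hf : Measurable f) (m : E2) (t : ℝ) :
    Measurable (graphKernel f m t) := by
  unfold graphKernel
  have h : Measurable fun x => fderiv ℝ f x (x - m) := by
    have h1 := measurable_fderiv ℝ f
    have h2 : Continuous fun p : (E2 →L[ℝ] ℝ) × E2 => p.1 p.2 := by fun_prop
    exact h2.measurable.comp (h1.prodMk (by fun_prop))
  fun_prop

/-- The mean value inequality along the segment. The expansion is about the variable point `x` and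
evaluated at the projection `m` of the pole, because the numerator of `graphKernel` contains the
derivative at `x`. -/
theorem abs_taylor_remainder_le {f : E2 → ℝ} {D : Set E2} (hD : IsOpen D) (hconv : Convex ℝ D)
    {α C : ℝ} (hα : 0 < α) (hC : 0 ≤ C) (hf : DifferentiableOn ℝ f D)
    (hh : ∀ x ∈ D, ∀ y ∈ D, ‖fderiv ℝ f x - fderiv ℝ f y‖ ≤ C * ‖x - y‖ ^ α) {x m : E2}
    (hx : x ∈ D) (hm : m ∈ D) :
    |f m - f x - fderiv ℝ f x (m - x)| ≤ C * ‖x - m‖ ^ α * ‖x - m‖ := by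
  have hsub : segment ℝ x m ⊆ D := hconv.segment_subset hx hm
  have := (convex_segment (𝕜 := ℝ) x m).norm_image_sub_le_of_norm_fderiv_le' (f := f)
    (φ := fderiv ℝ f x) (C := C * ‖x - m‖ ^ α)
    (fun w hw => hf.differentiableAt (hD.mem_nhds (hsub hw))) (fun w hw => ?_)
    (left_mem_segment ℝ x m) (right_mem_segment ℝ x m)
  · rwa [norm_sub_rev m x] at this
  · refine (hh w (hsub hw) x hx).trans ?_
    have : ‖w - x‖ ≤ ‖x - m‖ := by
      rw [norm_sub_rev x m]
      exact norm_sub_le_of_mem_segment hw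
    gcongr

theorem exists_lipschitz_of_holder {f : E2 → ℝ} {x₀ : E2} {δ : ℝ} {α C : ℝ} (hδ : 0 < δ)
    (hα : 0 < α) (hC : 0 ≤ C)
    (hf : DifferentiableOn ℝ f (Metric.ball x₀ δ))
    (hh : ∀ x ∈ Metric.ball x₀ δ, ∀ y ∈ Metric.ball x₀ δ,
      ‖fderiv ℝ f x - fderiv ℝ f y‖ ≤ C * ‖x - y‖ ^ α) :
    ∃ L : ℝ, 0 ≤ L ∧ (∀ x ∈ Metric.ball x₀ δ, ‖fderiv ℝ f x‖ ≤ L) ∧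
      ∀ x ∈ Metric.ball x₀ δ, ∀ y ∈ Metric.ball x₀ δ, |f x - f y| ≤ L * ‖x - y‖ := by
  have hb : ∀ x ∈ Metric.ball x₀ δ, ‖fderiv ℝ f x‖ ≤ ‖fderiv ℝ f x₀‖ + C * δ ^ α := by
    intro x hx
    have h1 := hh x hx x₀ (Metric.mem_ball_self hδ)
    have h2 : ‖x - x₀‖ ≤ δ := by
      rw [← dist_eq_norm]
      exact (Metric.mem_ball.1 hx).le
    have h3 : C * ‖x - x₀‖ ^ α ≤ C * δ ^ α := by gcongr
    have h4 := norm_sub_norm_le (fderiv ℝ f x) (fderiv ℝ f x₀)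
    linarith
  refine ⟨‖fderiv ℝ f x₀‖ + C * δ ^ α, by positivity, hb, fun x hx y hy => ?_⟩
  exact (convex_ball x₀ δ).norm_image_sub_le_of_norm_fderiv_le
    (fun w hw => hf.differentiableAt (Metric.isOpen_ball.mem_nhds hw)) hb hy hx

/-- The kernel is dominated by an approximate identity at height `h` plus a weakly singular
kernel. -/
theorem abs_graphKernel_le {f : E2 → ℝ} {m x : E2} {t α C L : ℝ} (hC : 0 ≤ C)
    (htaylor : |f m - f x - fderiv ℝ f x (m - x)| ≤ C * ‖x - m‖ ^ α * ‖x - m‖)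
    (hlip : |f x - f m| ≤ L * ‖x - m‖) :
    |graphKernel f m t x| ≤
      √(2 + 2 * L ^ 2) ^ 3 * (|f m - t| / √(‖x - m‖ ^ 2 + (f m - t) ^ 2) ^ 3) +
        C * ‖x - m‖ ^ (α - 2) := by
  set ρ := ‖x - m‖ with hρ
  set h := f m - t with hh
  set g := f x - t with hg
  set r := √(ρ ^ 2 + g ^ 2) with hr
  set q := √(ρ ^ 2 + h ^ 2) with hq
  set K := √(2 + 2 * L ^ 2) with hK
  have hρ0 : 0 ≤ ρ := norm_nonneg _
  have hr0 : 0 ≤ r := Real.sqrt_nonneg _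
  have hK0 : 0 ≤ K := Real.sqrt_nonneg _
  have hρr : ρ ≤ r := Real.le_sqrt_of_sq_le (by nlinarith [sq_nonneg g])
  -- The true distance `r` to the pole is comparable with the distance `q` for a flat graph at
  -- height `h`: use `h² ≤ 2 g² + 2 (g - h)²` and the Lipschitz bound for `g - h`.
  have hqr : q ≤ K * r := by
    rw [hq, hK, hr, ← Real.sqrt_mul (by positivity)]
    apply Real.sqrt_le_sqrt
    have h1 : |g - h| ≤ L * ρ := by simpa [hg, hh] using hlip
    have h2 : (g - h) ^ 2 ≤ (L * ρ) ^ 2 := sq_le_sq' (by linarith [neg_abs_le (g - h)])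
      (by linarith [le_abs_self (g - h)])
    nlinarith [sq_nonneg (2 * g - h), sq_nonneg (L * g), sq_nonneg ρ]
  -- The numerator is `h` minus the Taylor remainder.
  have hnum : |f x - t - fderiv ℝ f x (x - m)| ≤ |h| + C * ρ ^ α * ρ := by
    have : f x - t - fderiv ℝ f x (x - m) = h - (f m - f x - fderiv ℝ f x (m - x)) := by
      rw [← neg_sub x m, map_neg, hh]
      ring
    rw [this]
    exact (abs_sub _ _).trans (by linarith)
  have hk : |graphKernel f m t x| ≤ |h| / r ^ 3 + C * ρ ^ α * ρ / r ^ 3 := by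
    rw [graphKernel, abs_div, abs_of_nonneg (a := _ ^ 3) (by positivity), ← add_div]
    gcongr
  refine hk.trans (add_le_add ?_ ?_)
  · rcases eq_or_ne h 0 with h0 | h0
    · simp [h0]
    · have hqpos : 0 < q := Real.sqrt_pos.2 (by positivity)
      have hrpos : 0 < r := by
        rcases hr0.eq_or_lt with h1 | h1
        · rw [← h1] at hqr
          linarith
        · exact h1
      rw [← mul_div_assoc, div_le_div_iff₀ (by positivity) (by positivity)]
      calc |h| * q ^ 3 ≤ |h| * (K * r) ^ 3 := by gcongr
        _ = _ := by ring
  · rcases hρ0.eq_or_lt with h0 | h0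
    · rw [← h0]
      simp only [mul_zero, zero_div]
      positivity
    · have hrpos : 0 < r := h0.trans_le hρr
      calc C * ρ ^ α * ρ / r ^ 3 ≤ C * ρ ^ α * ρ / ρ ^ 3 := by gcongr
        _ = C * ρ ^ (α - 2) := by
          rw [Real.rpow_sub h0, Real.rpow_two]
          field_simp

/-- The substitution `y ↦ y / |h|` removes `h` from the integral when `h ≠ 0`, and for `h = 0` the
integrand vanishes. Integrability holds because the profile decays like `‖y‖ ^ (-3)` in dimension
two. -/
theorem exists_integral_poisson_le :
    ∃ A : ℝ, ∀ h : ℝ, Integrable (fun y : E2 => |h| / √(‖y‖ ^ 2 + h ^ 2) ^ 3) ∧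
      ∫ y : E2, |h| / √(‖y‖ ^ 2 + h ^ 2) ^ 3 ≤ A := by
  set p : E2 → ℝ := fun y => 1 / √(1 + ‖y‖ ^ 2) ^ 3 with hp
  have hpi : Integrable p := by
    have := integrable_rpow_neg_one_add_norm_sq (E := E2) (μ := volume) (r := 3)
      (by simp; norm_num)
    refine this.congr (ae_of_all _ fun y => ?_)
    have h1 : (0 : ℝ) ≤ 1 + ‖y‖ ^ 2 := by positivity
    simp only [hp]
    rw [neg_div, Real.rpow_neg h1, one_div, Real.sqrt_eq_rpow, ← Real.rpow_natCast (_ ^ (1 / 2 : ℝ)),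
      ← Real.rpow_mul h1]
    norm_num
  refine ⟨∫ y, p y, fun h => ?_⟩
  rcases eq_or_ne h 0 with rfl | h0
  · simp only [abs_zero, zero_div, integral_zero]
    exact ⟨integrable_zero _ _ _, integral_nonneg fun y => by positivity⟩
  · have hpos : 0 < |h| := abs_pos.2 h0
    have heq : (fun y : E2 => |h| / √(‖y‖ ^ 2 + h ^ 2) ^ 3) =
        fun y => (|h| ^ 2)⁻¹ * p (|h|⁻¹ • y) := by
      funext y
      have : ‖y‖ ^ 2 + h ^ 2 = |h| ^ 2 * (1 + ‖|h|⁻¹ • y‖ ^ 2) := by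
        rw [norm_smul, norm_inv, Real.norm_eq_abs, abs_abs, ← sq_abs h]
        field_simp
        ring
      rw [this, Real.sqrt_mul (by positivity), Real.sqrt_sq hpos.le]
      simp only [hp]
      field_simp
    rw [heq]
    refine ⟨((integrable_comp_smul_iff volume p (inv_ne_zero hpos.ne')).2 hpi).const_mul _, ?_⟩
    rw [integral_const_mul, Measure.integral_comp_smul]
    simp only [finrank_euclideanSpace, Fintype.card_fin, inv_pow, inv_inv, smul_eq_mul, abs_pow,
      abs_abs]
    rw [← mul_assoc, inv_mul_cancel₀ (by positivity), one_mul]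


theorem integrableOn_norm_rpow {β : ℝ} (hβ : -2 < β) (r : ℝ) :
    IntegrableOn (fun y : E2 => ‖y‖ ^ β) (Metric.ball 0 r) := by
  refine integrableOn_ball_of_norm_le_rpow (C := 1) (α := -β) (by simp) (by simp; linarith) ?_ ?_
  · refine ae_of_all _ fun x => ?_
    rw [Real.norm_of_nonneg (by positivity), neg_neg, one_mul]
  · exact (by fun_prop : Measurable fun y : E2 => ‖y‖ ^ β).aestronglyMeasurable

/-- The solid angle kernel of a `C^{1,α}` graph is integrable with respect to the point of the
graph, uniformly in the pole. -/
theorem exists_integral_abs_graphKernel_le {f : E2 → ℝ} (hfm : Measurable f) {x₀ : E2} {δ α C : ℝ}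
    (hδ : 0 < δ) (hα : 0 < α) (hC : 0 ≤ C) (hf : DifferentiableOn ℝ f (Metric.ball x₀ δ))
    (hh : ∀ x ∈ Metric.ball x₀ δ, ∀ y ∈ Metric.ball x₀ δ,
      ‖fderiv ℝ f x - fderiv ℝ f y‖ ≤ C * ‖x - y‖ ^ α) :
    ∃ B : ℝ, ∀ m ∈ Metric.ball x₀ δ, ∀ t : ℝ,
      IntegrableOn (graphKernel f m t) (Metric.ball x₀ δ) ∧
      ∫ x in Metric.ball x₀ δ, |graphKernel f m t x| ≤ B := by
  obtain ⟨A, hA⟩ := exists_integral_poisson_le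
  obtain ⟨L, hL0, -, hL⟩ := exists_lipschitz_of_holder hδ hα hC hf hh
  set Q := √(2 + 2 * L ^ 2) ^ 3 with hQ
  have hQ0 : 0 ≤ Q := by positivity
  -- Two points of the disc differ by less than `2 * δ`, so after translating the pole to the origin
  -- one fixed dominating function serves every `m`.
  have hS := integrableOn_norm_rpow (β := α - 2) (by linarith) (2 * δ)
  set S := (Metric.ball (0 : E2) (2 * δ)).indicator fun y => ‖y‖ ^ (α - 2) with hSdef
  have hSi : Integrable S := (integrable_indicator_iff Metric.isOpen_ball.measurableSet).2 hS
  refine ⟨Q * A + C * ∫ y, S y, fun m hm t => ?_⟩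
  obtain ⟨hPi, hPA⟩ := hA (f m - t)
  set P : E2 → ℝ := fun y => |f m - t| / √(‖y‖ ^ 2 + (f m - t) ^ 2) ^ 3 with hP
  set G : E2 → ℝ := fun y => Q * P y + C * S y with hG
  have hGi : Integrable G := (hPi.const_mul Q).add (hSi.const_mul C)
  have hGm : Integrable fun x => G (x - m) := hGi.comp_sub_right m
  have hG0 : ∀ y, 0 ≤ G y := fun y => by
    have : 0 ≤ S y := indicator_nonneg (fun y _ => by positivity) y
    simp only [hG, hP]
    positivity
  have hbound : ∀ x ∈ Metric.ball x₀ δ, |graphKernel f m t x| ≤ G (x - m) := by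
    intro x hx
    have hmem : x - m ∈ Metric.ball (0 : E2) (2 * δ) := by
      rw [mem_ball_zero_iff, ← dist_eq_norm]
      have := dist_triangle_right x m x₀
      rw [Metric.mem_ball] at hx hm
      linarith
    have := abs_graphKernel_le (t := t) hC (abs_taylor_remainder_le Metric.isOpen_ball
      (convex_ball x₀ δ) hα hC hf hh hx hm) (hL x hx m hm)
    simpa only [hG, hP, hSdef, indicator_of_mem hmem] using this
  have hint : IntegrableOn (graphKernel f m t) (Metric.ball x₀ δ) := by
    refine hGm.integrableOn.mono' (measurable_graphKernel hfm m t).aestronglyMeasurable ?_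
    exact ae_restrict_of_forall_mem Metric.isOpen_ball.measurableSet hbound
  refine ⟨hint, ?_⟩
  calc ∫ x in Metric.ball x₀ δ, |graphKernel f m t x|
      ≤ ∫ x in Metric.ball x₀ δ, G (x - m) :=
        setIntegral_mono_on hint.abs hGm.integrableOn Metric.isOpen_ball.measurableSet hbound
    _ ≤ ∫ x, G (x - m) := setIntegral_le_integral hGm (ae_of_all _ fun x => hG0 _)
    _ = ∫ y, G y := integral_sub_right_eq_self G m
    _ = Q * (∫ y, P y) + C * ∫ y, S y := by
        rw [integral_add (hPi.const_mul Q) (hSi.const_mul C), integral_const_mul,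
          integral_const_mul]
    _ ≤ _ := by gcongr

/-! ### Polar coordinates in the plane -/

/-- The unit vector of the plane at angle `θ`. -/
noncomputable def unitVec (θ : ℝ) : E2 := !₂[Real.cos θ, Real.sin θ]

theorem norm_unitVec (θ : ℝ) : ‖unitVec θ‖ = 1 := by
  rw [EuclideanSpace.norm_eq, Real.sqrt_eq_one]
  simp [unitVec, Fin.sum_univ_two]

theorem unitVec_add_pi (θ : ℝ) : unitVec (θ + π) = -unitVec θ := by
  ext j
  fin_cases j <;> simp [unitVec]

theorem continuous_unitVec : Continuous unitVec := by
  unfold unitVec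
  refine (PiLp.continuous_toLp 2 _).comp (continuous_pi fun j => ?_)
  fin_cases j
  · exact Real.continuous_cos
  · exact Real.continuous_sin

/-- The identification of `ℝ × ℝ` with the Euclidean plane. -/
noncomputable def planeEquiv : ℝ × ℝ ≃ᵐ E2 :=
  MeasurableEquiv.finTwoArrow.symm.trans (MeasurableEquiv.toLp 2 (Fin 2 → ℝ))

theorem measurePreserving_planeEquiv : MeasurePreserving planeEquiv volume volume :=
  (volume_preserving_finTwoArrow ℝ).symm.trans (PiLp.volume_preserving_toLp (Fin 2))

theorem planeEquiv_polarCoord_symm (p : ℝ × ℝ) :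
    planeEquiv (polarCoord.symm p) = p.1 • unitVec p.2 := by
  ext j
  fin_cases j <;> simp [planeEquiv, unitVec, polarCoord, MeasurableEquiv.finTwoArrow,
    MeasurableEquiv.piFinTwo]

theorem smul_unitVec_mem_ball_iff {r R θ : ℝ} (hr : 0 < r) :
    r • unitVec θ ∈ Metric.ball (0 : E2) R ↔ r < R := by
  rw [mem_ball_zero_iff, norm_smul, norm_unitVec, mul_one, Real.norm_of_nonneg hr.le]

theorem polar_indicator_eq {β : Type*} [Zero β] (F : E2 → β) (R : ℝ) (p : ℝ × ℝ)
    (hp : p ∈ polarCoord.target) :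
    (Metric.ball (0 : E2) R).indicator F (planeEquiv (polarCoord.symm p)) =
      (Ioo 0 R ×ˢ Ioo (-π) π).indicator (fun p => F (p.1 • unitVec p.2)) p := by
  obtain ⟨h1, h2⟩ := hp
  rw [planeEquiv_polarCoord_symm]
  by_cases h : p.1 < R
  · have hm : p ∈ Ioo 0 R ×ˢ Ioo (-π) π := ⟨⟨h1, h⟩, h2⟩
    rw [indicator_of_mem ((smul_unitVec_mem_ball_iff h1).2 h), indicator_of_mem hm]
  · rw [indicator_of_notMem (fun h' => h ((smul_unitVec_mem_ball_iff h1).1 h')),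
      indicator_of_notMem (fun h' => h h'.1.2)]

theorem polar_rectangle_subset (R : ℝ) : Ioo 0 R ×ˢ Ioo (-π) π ⊆ polarCoord.target :=
  prod_mono Ioo_subset_Ioi_self subset_rfl

/-- Polar coordinates on a disc. -/
theorem setIntegral_ball_eq_polar (F : E2 → ℝ) (R : ℝ) :
    ∫ y in Metric.ball (0 : E2) R, F y =
      ∫ p in Ioo 0 R ×ˢ Ioo (-π) π, p.1 * F (p.1 • unitVec p.2) := by
  have hm : MeasurableSet (Ioo 0 R ×ˢ Ioo (-π) π) := measurableSet_Ioo.prod measurableSet_Ioo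
  rw [← integral_indicator Metric.isOpen_ball.measurableSet,
    ← measurePreserving_planeEquiv.integral_comp planeEquiv.measurableEmbedding,
    ← integral_comp_polarCoord_symm,
    setIntegral_congr_fun polarCoord.open_target.measurableSet
      (g := (Ioo 0 R ×ˢ Ioo (-π) π).indicator fun p => p.1 * F (p.1 • unitVec p.2)),
    setIntegral_indicator hm, inter_eq_right.2 (polar_rectangle_subset R)]
  intro p hp
  simp only [polar_indicator_eq F R p hp, smul_eq_mul]
  by_cases h : p ∈ Ioo 0 R ×ˢ Ioo (-π) π <;> simp [h]

theorem setLIntegral_ball_eq_polar (F : E2 → ℝ≥0∞) (R : ℝ) :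
    ∫⁻ y in Metric.ball (0 : E2) R, F y =
      ∫⁻ p in Ioo 0 R ×ˢ Ioo (-π) π, ENNReal.ofReal p.1 * F (p.1 • unitVec p.2) := by
  have hm : MeasurableSet (Ioo 0 R ×ˢ Ioo (-π) π) := measurableSet_Ioo.prod measurableSet_Ioo
  rw [← lintegral_indicator Metric.isOpen_ball.measurableSet,
    ← measurePreserving_planeEquiv.lintegral_comp_emb planeEquiv.measurableEmbedding,
    ← lintegral_comp_polarCoord_symm,
    setLIntegral_congr_fun polarCoord.open_target.measurableSet
      (g := (Ioo 0 R ×ˢ Ioo (-π) π).indicator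
        fun p => ENNReal.ofReal p.1 * F (p.1 • unitVec p.2)),
    setLIntegral_indicator hm, inter_eq_left.2 (polar_rectangle_subset R)]
  intro p hp
  simp only [polar_indicator_eq F R p hp, smul_eq_mul]
  by_cases h : p ∈ Ioo 0 R ×ˢ Ioo (-π) π <;> simp [h]

theorem integrableOn_polar {F : E2 → ℝ} (hF : Measurable F) {R : ℝ}
    (hi : IntegrableOn F (Metric.ball 0 R)) :
    IntegrableOn (fun p : ℝ × ℝ => p.1 * F (p.1 • unitVec p.2)) (Ioo 0 R ×ˢ Ioo (-π) π) := by
  have hu := continuous_unitVec.measurable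
  refine ⟨(by fun_prop : Measurable fun p : ℝ × ℝ =>
    p.1 * F (p.1 • unitVec p.2)).aestronglyMeasurable, ?_⟩
  have h1 := hi.2
  rw [hasFiniteIntegral_iff_enorm, setLIntegral_ball_eq_polar] at h1
  rw [hasFiniteIntegral_iff_enorm]
  refine lt_of_eq_of_lt (setLIntegral_congr_fun (measurableSet_Ioo.prod measurableSet_Ioo)
    fun p hp => ?_) h1
  simp only [enorm_mul, Real.enorm_of_nonneg hp.1.1.le]

/-- Fubini in polar coordinates, the radial integral being the inner one. -/
theorem setIntegral_ball_eq_angular {F : E2 → ℝ} (hF : Measurable F) {R : ℝ} {H : ℝ → ℝ}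
    (hi : IntegrableOn F (Metric.ball 0 R))
    (hH : ∀ θ, IntegrableOn (fun r => r * F (r • unitVec θ)) (Ioo 0 R) →
      ∫ r in Ioo 0 R, r * F (r • unitVec θ) = H θ) :
    ∫ y in Metric.ball (0 : E2) R, F y = ∫ θ in Ioo (-π) π, H θ := by
  have hp := integrableOn_polar hF hi
  rw [IntegrableOn, Measure.volume_eq_prod, ← Measure.prod_restrict] at hp
  rw [setIntegral_ball_eq_polar, Measure.volume_eq_prod, ← Measure.prod_restrict,
    integral_prod_symm _ hp]
  refine integral_congr_ae ?_
  -- Fubini gives radial integrability only for almost every angle, which is why `hH` may assume it.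
  filter_upwards [hp.prod_left_ae] with θ hθ
  exact hH θ hθ

/-! ### Exact integration over a disc about the pole -/

/-- The radial primitive behind the whole computation: `g r / √(r² + g r²)` is the sine of the
elevation of the sight line, and its negative has the polar integrand as derivative. -/
theorem hasDerivAt_div_sqrt {g : ℝ → ℝ} {g' r : ℝ} (hr : 0 < r) (hg : HasDerivAt g g' r) :
    HasDerivAt (fun r => -(g r / √(r ^ 2 + g r ^ 2)))
      (r * ((g r - r * g') / √(r ^ 2 + g r ^ 2) ^ 3)) r := by
  have hpos : 0 < r ^ 2 + g r ^ 2 := by positivity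
  have hq : 0 < √(r ^ 2 + g r ^ 2) := Real.sqrt_pos.2 hpos
  have hq2 : √(r ^ 2 + g r ^ 2) ^ 2 = r ^ 2 + g r ^ 2 := Real.sq_sqrt hpos.le
  have h1 : HasDerivAt (fun r => r ^ 2 + g r ^ 2) (2 * r + 2 * g r * g') r := by
    refine ((hasDerivAt_pow 2 r).add (hg.pow 2)).congr_deriv ?_
    simp
  have h2 := (hg.div (h1.sqrt hpos.ne') hq.ne').neg
  refine h2.congr_deriv ?_
  field_simp
  rw [hq2]
  ring

/-- The radial integral of the solid angle density of a graph. -/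
theorem integral_radial_eq {g g' : ℝ → ℝ} {R : ℝ} (hR : 0 < R)
    (hg : ∀ r ∈ Icc 0 R, HasDerivAt g (g' r) r)
    (hi : IntegrableOn (fun r => r * ((g r - r * g' r) / √(r ^ 2 + g r ^ 2) ^ 3)) (Ioo 0 R)) :
    ∫ r in Ioo 0 R, r * ((g r - r * g' r) / √(r ^ 2 + g r ^ 2) ^ 3) =
      (if g 0 = 0 then g' 0 / √(1 + g' 0 ^ 2) else Real.sign (g 0)) - g R / √(R ^ 2 + g R ^ 2) := by
  have h0 : (0 : ℝ) ∈ Icc 0 R := ⟨le_rfl, hR.le⟩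
  have hRm : R ∈ Icc 0 R := ⟨hR.le, le_rfl⟩
  have hii : IntervalIntegrable (fun r => r * ((g r - r * g' r) / √(r ^ 2 + g r ^ 2) ^ 3))
      volume 0 R := (intervalIntegrable_iff_integrableOn_Ioo_of_le hR.le).2 hi
  -- One-sided limits of the primitive are needed at `0`: if `g 0 = 0`, the quotient there is `0 /
  -- 0` with default value `0`, while its limit depends on the slope `g' 0`.
  rw [← integral_Ioc_eq_integral_Ioo, ← intervalIntegral.integral_of_le hR.le,
    intervalIntegral.integral_eq_sub_of_hasDerivAt_of_tendsto hR
      (fun r hr => hasDerivAt_div_sqrt hr.1 (hg r (Ioo_subset_Icc_self hr))) hii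
      (fa := -(if g 0 = 0 then g' 0 / √(1 + g' 0 ^ 2) else Real.sign (g 0)))
      (fb := -(g R / √(R ^ 2 + g R ^ 2)))]
  · ring
  · refine Tendsto.neg ?_
    have hc0 := (hg 0 h0).continuousAt
    split_ifs with hz
    · have hs : Tendsto (fun r => g r / r) (𝓝[>] 0) (𝓝 (g' 0)) := by
        have := (hasDerivAt_iff_tendsto_slope.1 (hg 0 h0)).mono_left
          (nhdsWithin_mono 0 (fun r (hr : 0 < r) => hr.ne'))
        refine this.congr fun r => ?_
        simp [slope_def_field, hz]
      have hlim : Tendsto (fun r => (g r / r) / √(1 + (g r / r) ^ 2)) (𝓝[>] 0)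
          (𝓝 (g' 0 / √(1 + g' 0 ^ 2))) := by
        refine hs.div ((tendsto_const_nhds.add (hs.pow 2)).sqrt) ?_
        exact (Real.sqrt_pos.2 (by positivity)).ne'
      refine hlim.congr' ?_
      filter_upwards [self_mem_nhdsWithin] with r (hr : 0 < r)
      have : r ^ 2 + g r ^ 2 = r ^ 2 * (1 + (g r / r) ^ 2) := by
        field_simp
      rw [this, Real.sqrt_mul (by positivity), Real.sqrt_sq hr.le, div_div]
    · have hne : √((0 : ℝ) ^ 2 + g 0 ^ 2) ≠ 0 := (Real.sqrt_pos.2 (by positivity)).ne'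
      have : ContinuousAt (fun r => g r / √(r ^ 2 + g r ^ 2)) 0 := by
        refine hc0.div ?_ hne
        exact ((continuousAt_id.pow 2).add (hc0.pow 2)).sqrt
      have h2 : g 0 / √((0 : ℝ) ^ 2 + g 0 ^ 2) = Real.sign (g 0) := by
        rw [zero_pow two_ne_zero, zero_add, Real.sqrt_sq_eq_abs]
        rcases lt_or_gt_of_ne hz with h | h
        · rw [Real.sign_of_neg h, abs_of_neg h, div_neg, div_self hz]
        · rw [Real.sign_of_pos h, abs_of_pos h, div_self hz]
      rw [← h2]
      exact this.tendsto.mono_left nhdsWithin_le_nhds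
  · have hcR := (hg R hRm).continuousAt
    have : ContinuousAt (fun r => -(g r / √(r ^ 2 + g r ^ 2))) R := by
      refine (hcR.div (g := fun r => √(r ^ 2 + g r ^ 2)) ?_
        (Real.sqrt_pos.2 (by positivity)).ne').neg
      exact ((continuousAt_id.pow 2).add (hcR.pow 2)).sqrt
    exact this.tendsto.mono_left nhdsWithin_le_nhds

/-- A function on the circle which is odd under the antipodal map integrates to zero. -/
theorem integral_eq_zero_of_antipodal {a : ℝ → ℝ} (ha : ∀ θ, a (θ + π) = -a θ) :
    ∫ θ in Ioo (-π) π, a θ = 0 := by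
  have hper : Function.Periodic a (2 * π) := fun θ => by
    rw [two_mul, ← add_assoc, ha, ha, neg_neg]
  -- By `2π`-periodicity a shift by `π` preserves the integral, while by oddness it reverses its
  -- sign.
  have h1 : ∫ θ in (-π)..π, a θ = ∫ θ in (-π + π)..(π + π), a θ := by
    have := hper.intervalIntegral_add_eq (-π) 0
    rw [show -π + 2 * π = π by ring, zero_add] at this
    rw [this, neg_add_cancel, two_mul]
  rw [← intervalIntegral.integral_comp_add_right] at h1
  simp only [ha, intervalIntegral.integral_neg] at h1
  rw [← integral_Ioc_eq_integral_Ioo, ← intervalIntegral.integral_of_le (by linarith [Real.pi_pos])]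
  linarith

/-- The slope of the sight line from `(m, t)` to the point of the graph of `f` at distance `R` and
angle `θ` from `m`. -/
noncomputable def rimAngle (f : E2 → ℝ) (R : ℝ) (m : E2) (t θ : ℝ) : ℝ :=
  (f (m + R • unitVec θ) - t) / √(R ^ 2 + (f (m + R • unitVec θ) - t) ^ 2)

theorem abs_rimAngle_le (f : E2 → ℝ) (R : ℝ) (m : E2) (t θ : ℝ) : |rimAngle f R m t θ| ≤ 1 := by
  rw [rimAngle, abs_div, abs_of_nonneg (Real.sqrt_nonneg _)]
  refine div_le_one_of_le₀ (Real.le_sqrt_of_sq_le ?_) (Real.sqrt_nonneg _)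
  rw [sq_abs]
  nlinarith [sq_nonneg R]

theorem measurable_rimAngle {f : E2 → ℝ} (hf : Measurable f) (R : ℝ) (m : E2) (t : ℝ) :
    Measurable (rimAngle f R m t) := by
  have := continuous_unitVec.measurable
  unfold rimAngle
  fun_prop

theorem integrableOn_rimAngle {f : E2 → ℝ} (hf : Measurable f) (R : ℝ) (m : E2) (t : ℝ) :
    IntegrableOn (rimAngle f R m t) (Ioo (-π) π) :=
  Measure.integrableOn_of_bounded (by simp) (measurable_rimAngle hf R m t).aestronglyMeasurable
    (M := 1) (ae_of_all _ fun θ => abs_rimAngle_le f R m t θ)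

/-- The solid angle subtended by a disc-shaped piece of a graph at a point of its axis, up to the
contribution of its rim. -/
theorem integral_graphKernel_ball {f : E2 → ℝ} (hfm : Measurable f) {m : E2} {t R : ℝ} (hR : 0 < R)
    (hf : ∀ x ∈ Metric.closedBall m R, DifferentiableAt ℝ f x)
    (hi : IntegrableOn (graphKernel f m t) (Metric.ball m R)) :
    ∫ x in Metric.ball m R, graphKernel f m t x =
      2 * π * Real.sign (f m - t) - ∫ θ in Ioo (-π) π, rimAngle f R m t θ := by
  have hpre : (fun y => m + y) ⁻¹' Metric.ball m R = Metric.ball (0 : E2) R := by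
    ext y
    simp
  have hmp : MeasurePreserving (fun y : E2 => m + y) volume volume :=
    measurePreserving_add_left volume m
  have hemb : MeasurableEmbedding fun y : E2 => m + y := measurableEmbedding_addLeft m
  set F : E2 → ℝ := fun y => graphKernel f m t (m + y) with hF
  have hFm : Measurable F := (measurable_graphKernel hfm m t).comp (measurable_const_add m)
  have hFi : IntegrableOn F (Metric.ball 0 R) := by
    rw [← hpre]
    exact (hmp.integrableOn_comp_preimage hemb).2 hi
  have hI : ∫ x in Metric.ball m R, graphKernel f m t x = ∫ y in Metric.ball (0 : E2) R, F y := by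
    rw [← hpre]
    exact (hmp.setIntegral_preimage_emb hemb _ _).symm
  set a : ℝ → ℝ := fun θ => fderiv ℝ f m (unitVec θ) with ha
  have hF' (θ r : ℝ) : F (r • unitVec θ) = ((f (m + r • unitVec θ) - t) -
      r * fderiv ℝ f (m + r • unitVec θ) (unitVec θ)) /
        √(r ^ 2 + (f (m + r • unitVec θ) - t) ^ 2) ^ 3 := by
    simp only [hF, graphKernel, add_sub_cancel_left, map_smul, smul_eq_mul, norm_smul,
      norm_unitVec, mul_one, Real.norm_eq_abs, sq_abs]
  rw [hI, setIntegral_ball_eq_angular hFm hFi (H := fun θ =>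
    (if f m - t = 0 then a θ / √(1 + a θ ^ 2) else Real.sign (f m - t)) - rimAngle f R m t θ)]
  -- For a pole on the graph the inner boundary term depends on the directional derivative, which is
  -- odd under `θ ↦ θ + π`; for a pole off the graph it is the constant sign, integrated over length
  -- `2π`.
  · by_cases hz : f m - t = 0
    · simp only [hz, if_true, Real.sign_zero, mul_zero, zero_sub]
      have hca : Continuous fun θ => a θ / √(1 + a θ ^ 2) := by
        have hc : Continuous a := (fderiv ℝ f m).continuous.comp continuous_unitVec
        exact hc.div (by fun_prop) fun θ => (Real.sqrt_pos.2 (by positivity)).ne'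
      rw [integral_sub (hca.integrableOn_Icc.mono_set Ioo_subset_Icc_self)
        (integrableOn_rimAngle hfm R m t), integral_eq_zero_of_antipodal, zero_sub]
      intro θ
      simp [ha, unitVec_add_pi, neg_div]
    · simp only [hz, if_false]
      rw [integral_sub (integrable_const _) (integrableOn_rimAngle hfm R m t),
        setIntegral_const]
      congr 1
      rw [Measure.real, Real.volume_Ioo, ENNReal.toReal_ofReal (by linarith [Real.pi_pos]),
        smul_eq_mul]
      ring
  · intro θ hθ
    simp only [hF'] at hθ ⊢
    have := integral_radial_eq hR (g := fun r => f (m + r • unitVec θ) - t)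
      (g' := fun r => fderiv ℝ f (m + r • unitVec θ) (unitVec θ)) ?_ hθ
    · simpa [rimAngle, ha] using this
    · intro r hr
      have hmem : m + r • unitVec θ ∈ Metric.closedBall m R := by
        simp [norm_smul, norm_unitVec, abs_of_nonneg hr.1, hr.2]
      have hl : HasDerivAt (fun r : ℝ => m + r • unitVec θ) (unitVec θ) r := by
        simpa using ((hasDerivAt_id r).smul_const (unitVec θ)).const_add m
      exact ((hf _ hmem).hasFDerivAt.comp_hasDerivAt r hl).sub_const t

/-! ### The jump in graph coordinates -/

theorem continuousAt_graphKernel_pole (f : E2 → ℝ) {x : E2} {p : E2 × ℝ} (hx : x ≠ p.1) :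
    ContinuousAt (fun p : E2 × ℝ => graphKernel f p.1 p.2 x) p := by
  unfold graphKernel
  have h1 : 0 < ‖x - p.1‖ := norm_pos_iff.2 (sub_ne_zero.2 hx)
  have h2 : √(‖x - p.1‖ ^ 2 + (f x - p.2) ^ 2) ^ 3 ≠ 0 :=
    pow_ne_zero _ (Real.sqrt_pos.2 (by positivity)).ne'
  exact ContinuousAt.div (by fun_prop) (by fun_prop) h2

/-- Both terms of the numerator are bounded by multiples of the distance to the pole, which is at
least `R`. This dominates the kernel outside a disc about the pole, at any height `t`. -/
theorem abs_graphKernel_le_of_le {f : E2 → ℝ} {m x : E2} {t R L : ℝ} (hR : 0 < R)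
    (hx : R ≤ ‖x - m‖) (hL0 : 0 ≤ L) (hL : ‖fderiv ℝ f x‖ ≤ L) :
    |graphKernel f m t x| ≤ (1 + L) / R ^ 2 := by
  set r := √(‖x - m‖ ^ 2 + (f x - t) ^ 2) with hr
  have h1 : ‖x - m‖ ≤ r := Real.le_sqrt_of_sq_le (by nlinarith [sq_nonneg (f x - t)])
  have h2 : |f x - t| ≤ r := by
    apply Real.le_sqrt_of_sq_le
    rw [sq_abs]
    nlinarith [sq_nonneg ‖x - m‖]
  have hRr : R ≤ r := hx.trans h1
  have hr0 : 0 < r := hR.trans_le hRr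
  have h3 : |fderiv ℝ f x (x - m)| ≤ L * r :=
    ((fderiv ℝ f x).le_opNorm (x - m)).trans (by gcongr)
  have h4 : |f x - t - fderiv ℝ f x (x - m)| ≤ (1 + L) * r := (abs_sub _ _).trans (by linarith)
  rw [graphKernel, ← hr, abs_div, abs_of_nonneg (a := r ^ 3) (by positivity)]
  calc _ ≤ (1 + L) * r / r ^ 3 := by gcongr
    _ = (1 + L) / r ^ 2 := by field_simp
    _ ≤ _ := by gcongr

/-- The rim stays at horizontal distance `R` from the pole, so nothing degenerates when the pole
crosses the graph; the integrand is bounded by `1`. -/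
theorem continuousAt_integral_rimAngle {f : E2 → ℝ} (hfm : Measurable f) {R : ℝ} (hR : 0 < R)
    {p : E2 × ℝ} (hf : ∀ x ∈ Metric.closedBall p.1 R, ContinuousAt f x) :
    ContinuousAt (fun p : E2 × ℝ => ∫ θ in Ioo (-π) π, rimAngle f R p.1 p.2 θ) p := by
  refine continuousAt_of_dominated (bound := fun _ => 1)
    (Eventually.of_forall fun q => (measurable_rimAngle hfm R q.1 q.2).aestronglyMeasurable)
    (Eventually.of_forall fun q => ae_of_all _ fun θ => abs_rimAngle_le f R q.1 q.2 θ)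
    (integrable_const _) (ae_of_all _ fun θ => ?_)
  unfold rimAngle
  have hmem : p.1 + R • unitVec θ ∈ Metric.closedBall p.1 R := by
    simp [norm_smul, norm_unitVec, abs_of_pos hR]
  have h1 : ContinuousAt (fun q : E2 × ℝ => f (q.1 + R • unitVec θ)) p :=
    ContinuousAt.comp (f := fun q : E2 × ℝ => q.1 + R • unitVec θ) (hf _ hmem) (by fun_prop)
  exact ContinuousAt.div (by fun_prop) (by fun_prop) (Real.sqrt_pos.2 (by positivity)).ne'

/-- The removed disc moves with the pole. For fixed `x` the truncated kernel is continuous at the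
limiting pole unless `x` lies on the limiting circle, which is a null set. -/
theorem continuousAt_integral_graphKernel_diff_ball {f : E2 → ℝ} (hfm : Measurable f) {x₀ : E2}
    {δ R L : ℝ} (hR : 0 < R) (hL0 : 0 ≤ L) (hL : ∀ x ∈ Metric.ball x₀ δ, ‖fderiv ℝ f x‖ ≤ L)
    (t₀ : ℝ) :
    ContinuousAt (fun p : E2 × ℝ => ∫ x in Metric.ball x₀ δ,
      (Metric.ball p.1 R)ᶜ.indicator (graphKernel f p.1 p.2) x) (x₀, t₀) := by
  refine continuousAt_of_dominated (bound := fun _ => (1 + L) / R ^ 2)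
    (Eventually.of_forall fun q => ((measurable_graphKernel hfm q.1 q.2).indicator
      Metric.isOpen_ball.measurableSet.compl).aestronglyMeasurable)
    (Eventually.of_forall fun q => ae_restrict_of_forall_mem Metric.isOpen_ball.measurableSet
      fun x hx => ?_)
    (integrableOn_const measure_ball_lt_top.ne) ?_
  · by_cases h : x ∈ (Metric.ball q.1 R)ᶜ
    · rw [indicator_of_mem h]
      rw [mem_compl_iff, Metric.mem_ball, not_lt, dist_eq_norm] at h
      exact abs_graphKernel_le_of_le hR h hL0 (hL x hx)
    · rw [indicator_of_notMem h, norm_zero]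
      positivity
  · have hnull : ∀ᵐ x ∂(volume.restrict (Metric.ball x₀ δ)), x ∉ Metric.sphere x₀ R :=
      ae_restrict_of_ae (measure_eq_zero_iff_ae_notMem.1 (Measure.addHaar_sphere volume x₀ R))
    filter_upwards [hnull] with x hx
    have hc : ContinuousAt (fun q : E2 × ℝ => dist x q.1) (x₀, t₀) := by fun_prop
    rcases lt_or_gt_of_ne hx with h | h
    · have : (fun q : E2 × ℝ => (Metric.ball q.1 R)ᶜ.indicator (graphKernel f q.1 q.2) x)
          =ᶠ[𝓝 (x₀, t₀)] fun _ => 0 := by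
        filter_upwards [hc.eventually (gt_mem_nhds h)] with q hq
        exact indicator_of_notMem (not_not_intro (Metric.mem_ball.2 hq)) _
      exact continuousAt_const.congr this.symm
    · have : (fun q : E2 × ℝ => (Metric.ball q.1 R)ᶜ.indicator (graphKernel f q.1 q.2) x)
          =ᶠ[𝓝 (x₀, t₀)] fun q => graphKernel f q.1 q.2 x := by
        filter_upwards [hc.eventually (lt_mem_nhds h)] with q hq
        exact indicator_of_mem (s := (Metric.ball q.1 R)ᶜ)
          (fun h' => lt_asymm (Metric.mem_ball.1 h') hq) _
      refine ContinuousAt.congr (continuousAt_graphKernel_pole f ?_) this.symm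
      rintro rfl
      simp only [dist_self] at h
      exact lt_asymm h hR

/-- The solid angle of a graph at a pole crossing the graph jumps by `2π` on either side. -/
theorem tendsto_integral_graphKernel_sub_sign {f : E2 → ℝ} (hfm : Measurable f) {x₀ : E2}
    {δ L : ℝ} (hδ : 0 < δ) (hf : DifferentiableOn ℝ f (Metric.ball x₀ δ)) (hL0 : 0 ≤ L)
    (hL : ∀ x ∈ Metric.ball x₀ δ, ‖fderiv ℝ f x‖ ≤ L)
    (hi : ∀ m ∈ Metric.ball x₀ δ, ∀ t, IntegrableOn (graphKernel f m t) (Metric.ball x₀ δ)) :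
    Tendsto (fun p : E2 × ℝ => (∫ x in Metric.ball x₀ δ, graphKernel f p.1 p.2 x) -
        2 * π * Real.sign (f p.1 - p.2)) (𝓝 (x₀, f x₀))
      (𝓝 (∫ x in Metric.ball x₀ δ, graphKernel f x₀ (f x₀) x)) := by
  -- Half the radius keeps the closed disc about every nearby `m` inside the domain of `f`.
  set R := δ / 2 with hR
  have hR0 : 0 < R := by positivity
  have hsub : ∀ m ∈ Metric.ball x₀ R, Metric.closedBall m R ⊆ Metric.ball x₀ δ := by
    intro m hm x hx
    rw [Metric.mem_ball] at hm ⊢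
    rw [Metric.mem_closedBall] at hx
    linarith [dist_triangle x m x₀]
  have hdiff : ∀ x ∈ Metric.ball x₀ δ, DifferentiableAt ℝ f x := fun x hx =>
    hf.differentiableAt (Metric.isOpen_ball.mem_nhds hx)
  set G : E2 × ℝ → ℝ := fun p => (∫ x in Metric.ball x₀ δ,
    (Metric.ball p.1 R)ᶜ.indicator (graphKernel f p.1 p.2) x) -
      ∫ θ in Ioo (-π) π, rimAngle f R p.1 p.2 θ with hG
  have hsplit : ∀ p : E2 × ℝ, p.1 ∈ Metric.ball x₀ R →
      (∫ x in Metric.ball x₀ δ, graphKernel f p.1 p.2 x) - 2 * π * Real.sign (f p.1 - p.2) =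
        G p := by
    intro p hp
    have hbm : MeasurableSet (Metric.ball p.1 R) := Metric.isOpen_ball.measurableSet
    have hsubp := Metric.ball_subset_closedBall.trans (hsub _ hp)
    have hip := hi p.1 (hsub _ hp (Metric.mem_closedBall_self hR0.le)) p.2
    have h1 := integral_graphKernel_ball hfm (m := p.1) (t := p.2) hR0
      (fun x hx => hdiff x (hsub _ hp hx)) (hip.mono_set hsubp)
    have h2 := integral_inter_add_sdiff hbm hip
    rw [inter_eq_right.2 hsubp, h1] at h2
    simp only [hG]
    rw [setIntegral_indicator hbm.compl, ← sdiff_eq, ← h2]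
    ring
  have hcont : ContinuousAt G (x₀, f x₀) :=
    (continuousAt_integral_graphKernel_diff_ball hfm hR0 hL0 hL (f x₀)).sub
      (continuousAt_integral_rimAngle hfm hR0 fun x hx =>
        (hdiff x (hsub _ (Metric.mem_ball_self hR0) hx)).continuousAt)
  -- Since `Real.sign 0 = 0`, the same formula at the limiting pole gives the direct value, halfway
  -- between the two one-sided limits.
  have h0 := hsplit (x₀, f x₀) (Metric.mem_ball_self hR0)
  simp only [sub_self, Real.sign_zero, mul_zero, sub_zero] at h0
  rw [h0]
  refine hcont.tendsto.congr' ?_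
  have : ∀ᶠ p : E2 × ℝ in 𝓝 (x₀, f x₀), p.1 ∈ Metric.ball x₀ R :=
    continuousAt_fst.eventually_mem (Metric.ball_mem_nhds x₀ hR0)
  filter_upwards [this] with p hp
  exact (hsplit p hp).symm

/-! ### The double-layer kernel and boundary patches -/

theorem lineDeriv_one_div_dist {P M n : E3} (h : P ≠ M) :
    lineDeriv ℝ (fun Q : E3 => 1 / dist Q M) P n = -inner ℝ (P - M) n / dist P M ^ 3 := by
  have hpos : 0 < ‖P - M‖ := norm_pos_iff.2 (sub_ne_zero.2 h)
  have h1 : HasDerivAt (fun t : ℝ => P - M + t • n) n 0 := by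
    simpa using ((hasDerivAt_id (0 : ℝ)).smul_const n).const_add (P - M)
  have h2 := h1.norm_sq
  simp only [zero_smul, add_zero] at h2
  have hne : ‖P - M + (0 : ℝ) • n‖ ^ 2 ≠ 0 := by simpa using hpos.ne'
  have h3 := (h2.sqrt hne).inv (by simpa using hpos.ne')
  simp only [Real.sqrt_sq (norm_nonneg _), zero_smul, add_zero] at h3
  rw [lineDeriv, dist_eq_norm]
  have h4 : (fun t : ℝ => 1 / dist (P + t • n) M) = (fun t : ℝ => ‖P - M + t • n‖)⁻¹ := by
    funext t
    rw [Pi.inv_apply, one_div, dist_eq_norm, add_sub_right_comm]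
  rw [h4, h3.deriv]
  field_simp

theorem doubleLayerKernel_eq {Ω : Set E3} {P M : E3} (h : P ≠ M) :
    doubleLayerKernel Ω M P = -inner ℝ (P - M) (exteriorNormal Ω P) / dist P M ^ 3 :=
  lineDeriv_one_div_dist h

theorem norm_exteriorNormal_le_one (Ω : Set E3) (P : E3) : ‖exteriorNormal Ω P‖ ≤ 1 := by
  rw [exteriorNormal]
  split_ifs with h
  · exact h.choose_spec.1.le
  · simp

theorem abs_doubleLayerKernel_le {Ω : Set E3} {P M : E3} {d : ℝ} (hd : 0 < d) (h : d ≤ dist P M) :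
    |doubleLayerKernel Ω M P| ≤ 1 / d ^ 2 := by
  have hpos : 0 < dist P M := hd.trans_le h
  rw [doubleLayerKernel_eq (dist_pos.1 hpos), abs_div, abs_neg,
    abs_of_nonneg (a := dist P M ^ 3) (by positivity)]
  have h1 : |inner ℝ (P - M) (exteriorNormal Ω P)| ≤ dist P M := by
    rw [dist_eq_norm]
    exact (abs_real_inner_le_norm _ _).trans
      (mul_le_of_le_one_right (norm_nonneg _) (norm_exteriorNormal_le_one Ω P))
  calc _ ≤ dist P M / dist P M ^ 3 := by gcongr
    _ = 1 / dist P M ^ 2 := by field_simp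
    _ ≤ _ := by gcongr

/-- In a suitable open neighbourhood `V` of a point of `∂Ω`, the boundary of `Ω` is the graph over
the whole disc of radius `ρ` about `x₀` of a function `f` which is measurable on the whole plane
and of class `C^{1,α}` on the disc. -/
structure IsGraphPatch (Ω : Set E3) (V : Set E3) (i : Fin 3) (s : ℝ) (f : E2 → ℝ) (x₀ : E2)
    (ρ α C L : ℝ) : Prop where
  isOpen : IsOpen V
  measurable : Measurable f
  radius_pos : 0 < ρ
  exponent_pos : 0 < α
  nonneg : 0 ≤ C
  nonneg_lip : 0 ≤ L
  sign : s = 1 ∨ s = -1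
  differentiableOn : DifferentiableOn ℝ f (Metric.ball x₀ ρ)
  holder : ∀ x ∈ Metric.ball x₀ ρ, ∀ y ∈ Metric.ball x₀ ρ,
    ‖fderiv ℝ f x - fderiv ℝ f y‖ ≤ C * ‖x - y‖ ^ α
  norm_fderiv_le : ∀ x ∈ Metric.ball x₀ ρ, ‖fderiv ℝ f x‖ ≤ L
  center_mem : graphMap i f x₀ ∈ V
  dropCoord_mem : ∀ P ∈ V, dropCoord i P ∈ Metric.ball x₀ ρ
  frontier_inter : frontier Ω ∩ V = graphMap i f '' Metric.ball x₀ ρ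
  interior : ∀ P ∈ V, P ∈ Ω → s * (P i - f (dropCoord i P)) < 0
  exterior : ∀ P ∈ V, P ∉ closure Ω → 0 < s * (P i - f (dropCoord i P))
  normal : ∀ P ∈ frontier Ω ∩ V,
    exteriorNormal Ω P = (s / ‖graphVector i f P‖) • graphVector i f P

theorem dist_dropCoord_le (i : Fin 3) (P Q : E3) :
    dist (dropCoord i P) (dropCoord i Q) ≤ dist P Q := by
  rw [dist_eq_norm, dist_eq_norm, ← dropCoord_sub]
  exact norm_dropCoord_le i _

/-- The function describing the boundary may be changed outside its disc, so that it becomes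
measurable. -/
theorem IsBoundaryGraph.exists_measurable {Ω : Set E3} {α : ℝ} {P₀ : E3} {δ : ℝ} {i : Fin 3}
    {s : ℝ} {f : E2 → ℝ} (h : IsBoundaryGraph Ω α P₀ δ i s f) :
    ∃ g : E2 → ℝ, Measurable g ∧ IsBoundaryGraph Ω α P₀ δ i s g := by
  set D := Metric.ball (dropCoord i P₀) δ with hD
  have hDo : IsOpen D := Metric.isOpen_ball
  have hfg : EqOn (D.indicator f) f D := fun x hx => indicator_of_mem hx f
  have hev : ∀ x ∈ D, D.indicator f =ᶠ[𝓝 x] f := fun x hx => hfg.eventuallyEq_of_mem (hDo.mem_nhds hx)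
  have hdrop : ∀ P ∈ Metric.ball P₀ δ, D.indicator f (dropCoord i P) = f (dropCoord i P) :=
    fun P hP => hfg (Metric.mem_ball.2 ((dist_dropCoord_le i P P₀).trans_lt hP))
  refine ⟨D.indicator f, ?_, ⟨h.radius_pos, h.sign, ⟨?_, ?_⟩, ?_, ?_, ?_⟩⟩
  · classical
    rw [← piecewise_eq_indicator]
    exact h.holder.1.continuousOn.measurable_piecewise continuousOn_const hDo.measurableSet
  · exact h.holder.1.congr hfg
  · obtain ⟨C, hC⟩ := h.holder.2
    refine ⟨C, fun x hx y hy => ?_⟩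
    rw [(hev x hx).fderiv_eq, (hev y hy).fderiv_eq]
    exact hC x hx y hy
  · intro P hP
    rw [hdrop P hP]
    exact h.boundary P hP
  · intro P hP
    rw [hdrop P hP]
    exact h.interior P hP
  · intro P hP
    rw [hdrop P hP]
    exact h.exterior P hP

/-- A graph over the full projected disc may leave the ball in which it describes `∂Ω`. Shrinking
the disc keeps the graph inside; the patch is the ball cut by the cylinder over the smaller disc. -/
theorem HasC1HolderBoundary.exists_isGraphPatch {Ω : Set E3} {α : ℝ} (hα : 0 < α)
    (hΩ : HasC1HolderBoundary Ω α) {P₀ : E3} (hP₀ : P₀ ∈ frontier Ω) :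
    ∃ (V : Set E3) (i : Fin 3) (s : ℝ) (f : E2 → ℝ) (ρ C L : ℝ),
      IsGraphPatch Ω V i s f (dropCoord i P₀) ρ α C L ∧ graphMap i f (dropCoord i P₀) = P₀ := by
  obtain ⟨δ, i, s, f', h'⟩ := hΩ P₀ hP₀
  obtain ⟨f, hfm, h⟩ := h'.exists_measurable
  set x₀ := dropCoord i P₀ with hx₀
  have hδ := h.radius_pos
  have hself : P₀ ∈ Metric.ball P₀ δ := Metric.mem_ball_self hδ
  have hgraph : graphMap i f x₀ = P₀ :=
    (eq_graphMap_iff.2 (sub_eq_zero.1 ((h.boundary P₀ hself).1 hP₀))).symm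
  obtain ⟨C', hC'⟩ := h.holder.2
  have hC : ∀ x ∈ Metric.ball x₀ δ, ∀ y ∈ Metric.ball x₀ δ,
      ‖fderiv ℝ f x - fderiv ℝ f y‖ ≤ |C'| * ‖x - y‖ ^ α := fun x hx y hy =>
    (hC' x hx y hy).trans (by gcongr; exact le_abs_self C')
  obtain ⟨L, hL0, hL, -⟩ := exists_lipschitz_of_holder hδ hα (abs_nonneg C') h.holder.1 hC
  have hfc : ContinuousAt f x₀ := (h.holder.1.continuousOn).continuousAt (Metric.ball_mem_nhds x₀ hδ)
  have hev : ∀ᶠ x in 𝓝 x₀, graphMap i f x ∈ Metric.ball P₀ δ := by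
    have hc : ContinuousAt (fun x => ‖x - x₀‖ ^ 2 + (f x - f x₀) ^ 2) x₀ := by fun_prop
    have h0 : ‖x₀ - x₀‖ ^ 2 + (f x₀ - f x₀) ^ 2 < δ ^ 2 := by simpa using pow_pos hδ 2
    filter_upwards [hc.eventually (gt_mem_nhds h0)] with x hx
    rw [← dist_graphMap_sq i, hgraph] at hx
    exact lt_of_pow_lt_pow_left₀ 2 hδ.le hx
  obtain ⟨ρ', hρ', hball⟩ := Metric.eventually_nhds_iff_ball.1 hev
  set ρ := min ρ' δ with hρ
  have hρpos : 0 < ρ := lt_min hρ' hδ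
  have hsubδ : Metric.ball x₀ ρ ⊆ Metric.ball x₀ δ := Metric.ball_subset_ball (min_le_right _ _)
  have hsubρ : ∀ x ∈ Metric.ball x₀ ρ, graphMap i f x ∈ Metric.ball P₀ δ := fun x hx =>
    hball x (Metric.ball_subset_ball (min_le_left _ _) hx)
  have hV : ∀ P, P ∈ Metric.ball P₀ δ ∩ dropCoord i ⁻¹' Metric.ball x₀ ρ ↔
      P ∈ Metric.ball P₀ δ ∧ dropCoord i P ∈ Metric.ball x₀ ρ := fun P => Iff.rfl
  have hVo : IsOpen (Metric.ball P₀ δ ∩ dropCoord i ⁻¹' Metric.ball x₀ ρ) :=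
    Metric.isOpen_ball.inter (Metric.isOpen_ball.preimage (continuous_dropCoord i))
  generalize Metric.ball P₀ δ ∩ dropCoord i ⁻¹' Metric.ball x₀ ρ = V at hV hVo
  refine ⟨V, i, s, f, ρ, |C'|, L, ?_, hgraph⟩
  exact
    { isOpen := hVo
      measurable := hfm
      radius_pos := hρpos
      exponent_pos := hα
      nonneg := abs_nonneg C'
      nonneg_lip := hL0
      sign := h.sign
      differentiableOn := h.holder.1.mono hsubδ
      holder := fun x hx y hy => hC x (hsubδ hx) y (hsubδ hy)
      norm_fderiv_le := fun x hx => hL x (hsubδ hx)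
      center_mem := by
        rw [hgraph, hV]
        exact ⟨hself, Metric.mem_ball_self hρpos⟩
      dropCoord_mem := fun P hP => ((hV P).1 hP).2
      frontier_inter := by
        ext P
        constructor
        · rintro ⟨hPf, hPV⟩
          obtain ⟨hPδ, hPρ⟩ := (hV P).1 hPV
          exact ⟨dropCoord i P, hPρ,
            (eq_graphMap_iff.2 (sub_eq_zero.1 ((h.boundary P hPδ).1 hPf))).symm⟩
        · rintro ⟨x, hx, rfl⟩
          refine ⟨(h.boundary _ (hsubρ x hx)).2 (by simp), (hV _).2 ⟨hsubρ x hx, ?_⟩⟩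
          rwa [dropCoord_graphMap]
      interior := fun P hP hPΩ => (h.interior P ((hV P).1 hP).1).1 hPΩ
      exterior := fun P hP hPΩ => (h.exterior P ((hV P).1 hP).1).1 hPΩ
      normal := fun P hP => h.exteriorNormal_eq_graphNormal hP.1 ((hV P).1 hP.2).1 }

/-- The length that normalizes the normal is the area element, so the two cancel in the kernel times
`dS`. -/
theorem norm_graphVector (i : Fin 3) (f : E2 → ℝ) (P : E3) :
    ‖graphVector i f P‖ = areaElement f (dropCoord i P) := by
  have h1 : dropCoord i (graphVector i f P) =
      -(InnerProductSpace.toDual ℝ E2).symm (fderiv ℝ f (dropCoord i P)) := by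
    ext k
    have hk : (InnerProductSpace.toDual ℝ E2).symm (fderiv ℝ f (dropCoord i P)) k =
        fderiv ℝ f (dropCoord i P) (EuclideanSpace.single k 1) := by
      rw [← InnerProductSpace.toDual_symm_apply (𝕜 := ℝ),
        EuclideanSpace.inner_single_right]
      simp
    rw [PiLp.neg_apply, hk]
    fin_cases k <;> simp [graphVector, dropCoord]
  have h2 : graphVector i f P i = 1 := by
    simp [graphVector]
  rw [areaElement, ← Real.sqrt_sq (norm_nonneg (graphVector i f P)), norm_sq_eq_sq_add_norm_sq i,
    h1, h2]
  simp

namespace IsGraphPatch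

variable {Ω V : Set E3} {i : Fin 3} {s : ℝ} {f : E2 → ℝ} {x₀ : E2} {ρ α C L : ℝ}

theorem continuousOn_fderiv (h : IsGraphPatch Ω V i s f x₀ ρ α C L) :
    ContinuousOn (fderiv ℝ f) (Metric.ball x₀ ρ) := by
  intro x hx
  rw [ContinuousWithinAt, tendsto_iff_norm_sub_tendsto_zero]
  have hα := h.exponent_pos
  have hlim : Tendsto (fun y => C * ‖y - x‖ ^ α) (𝓝[Metric.ball x₀ ρ] x) (𝓝 0) := by
    have hc : ContinuousAt (fun y => C * ‖y - x‖ ^ α) x :=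
      ((by fun_prop : ContinuousAt (fun y => ‖y - x‖) x).rpow_const (Or.inr hα.le)).const_mul C
    have := hc.tendsto.mono_left (nhdsWithin_le_nhds (s := Metric.ball x₀ ρ))
    simpa [Real.zero_rpow hα.ne'] using this
  refine squeeze_zero' (Eventually.of_forall fun y => norm_nonneg _) ?_ hlim
  filter_upwards [self_mem_nhdsWithin] with y hy
  exact h.holder y hy x hx

end IsGraphPatch

/-- Makes the value of the kernel at `P = M` irrelevant. -/
instance nullSingletonClass_euclideanHausdorffMeasure_two :
    NullSingletonClass (Measure.euclideanHausdorffMeasure 2 : Measure E3) := by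
  have : NullSingletonClass (Measure.hausdorffMeasure ((2 : ℕ) : ℝ) : Measure E3) :=
    Measure.nullSingletonClass_hausdorff E3 (by norm_num)
  rw [Measure.euclideanHausdorffMeasure_def]
  exact ⟨fun x => by rw [Measure.smul_apply, measure_singleton, smul_zero]⟩

/-! ### Constant density on a patch -/

namespace IsGraphPatch

variable {Ω V : Set E3} {i : Fin 3} {s : ℝ} {f : E2 → ℝ} {x₀ : E2} {ρ α C L : ℝ}

theorem graphMap_mem (h : IsGraphPatch Ω V i s f x₀ ρ α C L) {x : E2} (hx : x ∈ Metric.ball x₀ ρ) :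
    graphMap i f x ∈ frontier Ω ∩ V := by
  rw [h.frontier_inter]
  exact mem_image_of_mem _ hx

theorem areaElement_mul_doubleLayerKernel (h : IsGraphPatch Ω V i s f x₀ ρ α C L) {x : E2}
    (hx : x ∈ Metric.ball x₀ ρ) {M : E3} (hxM : x ≠ dropCoord i M) :
    areaElement f x * doubleLayerKernel Ω M (graphMap i f x) =
      -s * graphKernel f (dropCoord i M) (M i) x := by
  have hne : graphMap i f x ≠ M := by
    rintro rfl
    simp at hxM
  have hdist : dist (graphMap i f x) M = √(‖x - dropCoord i M‖ ^ 2 + (f x - M i) ^ 2) := by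
    rw [dist_eq_norm, ← Real.sqrt_sq (norm_nonneg (graphMap i f x - M)),
      norm_sq_eq_sq_add_norm_sq i, dropCoord_sub, dropCoord_graphMap, add_comm]
    simp
  have hJ : areaElement f x ≠ 0 := (zero_lt_one.trans_le (one_le_areaElement f x)).ne'
  rw [doubleLayerKernel_eq hne, h.normal _ (h.graphMap_mem hx), inner_smul_right, inner_graphVector,
    norm_graphVector, hdist, graphKernel, dropCoord_sub, dropCoord_graphMap]
  simp only [PiLp.sub_apply, graphMap_apply_self]
  field_simp

theorem ae_areaElement_mul_doubleLayerKernel (h : IsGraphPatch Ω V i s f x₀ ρ α C L) (M : E3) :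
    (fun x => areaElement f x * doubleLayerKernel Ω M (graphMap i f x)) =ᵐ[volume.restrict
      (Metric.ball x₀ ρ)] fun x => -s * graphKernel f (dropCoord i M) (M i) x := by
  filter_upwards [ae_restrict_mem Metric.isOpen_ball.measurableSet,
    ae_restrict_of_ae (Measure.ae_ne volume (dropCoord i M))] with x hx hne
  exact h.areaElement_mul_doubleLayerKernel hx hne

/-- The planar bound is uniform over all heights and over all `m` in the disc, and `V` projects into
the disc; hence one `B` covers poles on `∂Ω` and on both sides of it. -/
theorem exists_integral_abs_doubleLayerKernel_le (h : IsGraphPatch Ω V i s f x₀ ρ α C L) :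
    ∃ B : ℝ, ∀ M ∈ V,
      IntegrableOn (doubleLayerKernel Ω M) (frontier Ω ∩ V) (Measure.euclideanHausdorffMeasure 2) ∧
      ∫ P in frontier Ω ∩ V, |doubleLayerKernel Ω M P| ∂(Measure.euclideanHausdorffMeasure 2)
        ≤ B := by
  obtain ⟨B, hB⟩ := exists_integral_abs_graphKernel_le h.measurable h.radius_pos h.exponent_pos
    h.nonneg h.differentiableOn h.holder
  refine ⟨B, fun M hM => ?_⟩
  obtain ⟨hi, hle⟩ := hB _ (h.dropCoord_mem M hM) (M i)
  have hae := h.ae_areaElement_mul_doubleLayerKernel M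
  rw [h.frontier_inter]
  constructor
  · rw [integrableOn_graph_iff h.measurable Metric.isOpen_ball h.differentiableOn
      h.continuousOn_fderiv]
    exact (hi.const_mul (-s)).congr hae.symm
  · rw [setIntegral_graph h.measurable Metric.isOpen_ball h.differentiableOn
      h.continuousOn_fderiv]
    refine le_of_eq_of_le (integral_congr_ae ?_) hle
    filter_upwards [hae] with x hx
    calc areaElement f x * |doubleLayerKernel Ω M (graphMap i f x)|
        = |areaElement f x * doubleLayerKernel Ω M (graphMap i f x)| := by
          rw [abs_mul, abs_of_nonneg (zero_le_one.trans (one_le_areaElement f x))]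
      _ = _ := by rw [hx, abs_mul]
      _ = _ := ?_
    rcases h.sign with hs | hs <;> simp [hs]

theorem integral_doubleLayerKernel (h : IsGraphPatch Ω V i s f x₀ ρ α C L) (M : E3) :
    ∫ P in frontier Ω ∩ V, doubleLayerKernel Ω M P ∂(Measure.euclideanHausdorffMeasure 2) =
      -s * ∫ x in Metric.ball x₀ ρ, graphKernel f (dropCoord i M) (M i) x := by
  rw [h.frontier_inter, setIntegral_graph h.measurable Metric.isOpen_ball h.differentiableOn
      h.continuousOn_fderiv, integral_congr_ae (h.ae_areaElement_mul_doubleLayerKernel M),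
    integral_const_mul]

theorem tendsto_integral_doubleLayerKernel_add_sign (h : IsGraphPatch Ω V i s f x₀ ρ α C L) :
    Tendsto (fun M : E3 => (∫ P in frontier Ω ∩ V, doubleLayerKernel Ω M P
        ∂(Measure.euclideanHausdorffMeasure 2)) +
          2 * π * (s * Real.sign (f (dropCoord i M) - M i))) (𝓝 (graphMap i f x₀))
      (𝓝 (∫ P in frontier Ω ∩ V, doubleLayerKernel Ω (graphMap i f x₀) P
        ∂(Measure.euclideanHausdorffMeasure 2))) := by
  obtain ⟨B, hB⟩ := exists_integral_abs_graphKernel_le h.measurable h.radius_pos h.exponent_pos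
    h.nonneg h.differentiableOn h.holder
  have hplane := tendsto_integral_graphKernel_sub_sign h.measurable h.radius_pos h.differentiableOn
    h.nonneg_lip h.norm_fderiv_le fun m hm t => (hB m hm t).1
  have hcoord : Tendsto (fun M : E3 => (dropCoord i M, M i)) (𝓝 (graphMap i f x₀))
      (𝓝 (x₀, f x₀)) := by
    have h1 := (continuous_dropCoord i).tendsto (graphMap i f x₀)
    have h2 : Tendsto (fun M : E3 => M i) (𝓝 (graphMap i f x₀)) (𝓝 (graphMap i f x₀ i)) :=
      (by fun_prop : Continuous fun M : E3 => M i).tendsto _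
    rw [dropCoord_graphMap] at h1
    rw [graphMap_apply_self] at h2
    exact h1.prodMk_nhds h2
  have := (hplane.comp hcoord).const_mul (-s)
  simp only [h.integral_doubleLayerKernel, dropCoord_graphMap, graphMap_apply_self]
  refine this.congr fun M => ?_
  simp only [Function.comp_apply]
  ring

/-- The solid angle of a patch of `∂Ω` decreases by `2π` on approach from inside `Ω`. -/
theorem tendsto_integral_doubleLayerKernel_inside (h : IsGraphPatch Ω V i s f x₀ ρ α C L) :
    Tendsto (fun M : E3 => ∫ P in frontier Ω ∩ V, doubleLayerKernel Ω M P
        ∂(Measure.euclideanHausdorffMeasure 2)) (𝓝[Ω] (graphMap i f x₀))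
      (𝓝 ((∫ P in frontier Ω ∩ V, doubleLayerKernel Ω (graphMap i f x₀) P
        ∂(Measure.euclideanHausdorffMeasure 2)) - 2 * π)) := by
  have h1 := (h.tendsto_integral_doubleLayerKernel_add_sign.mono_left
    (nhdsWithin_le_nhds (s := Ω))).sub_const (2 * π)
  refine h1.congr' ?_
  filter_upwards [self_mem_nhdsWithin, mem_nhdsWithin_of_mem_nhds
    (h.isOpen.mem_nhds h.center_mem)] with M hM hMV
  have hint := h.interior M hMV hM
  -- Multiplication by `s` removes the orientation of the graph: on the side of `Ω` the product is
  -- `1` in both cases.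
  have : s * Real.sign (f (dropCoord i M) - M i) = 1 := by
    rcases h.sign with hs | hs <;> rw [hs] at hint ⊢
    · rw [Real.sign_of_pos (by linarith)]
      norm_num
    · rw [Real.sign_of_neg (by linarith)]
      norm_num
  rw [this]
  ring

/-- The solid angle of a patch of `∂Ω` increases by `2π` on approach from outside. -/
theorem tendsto_integral_doubleLayerKernel_outside (h : IsGraphPatch Ω V i s f x₀ ρ α C L) :
    Tendsto (fun M : E3 => ∫ P in frontier Ω ∩ V, doubleLayerKernel Ω M P
        ∂(Measure.euclideanHausdorffMeasure 2)) (𝓝[(closure Ω)ᶜ] (graphMap i f x₀))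
      (𝓝 ((∫ P in frontier Ω ∩ V, doubleLayerKernel Ω (graphMap i f x₀) P
        ∂(Measure.euclideanHausdorffMeasure 2)) + 2 * π)) := by
  have h1 := (h.tendsto_integral_doubleLayerKernel_add_sign.mono_left
    (nhdsWithin_le_nhds (s := (closure Ω)ᶜ))).add_const (2 * π)
  refine h1.congr' ?_
  filter_upwards [self_mem_nhdsWithin, mem_nhdsWithin_of_mem_nhds
    (h.isOpen.mem_nhds h.center_mem)] with M hM hMV
  have hint := h.exterior M hMV hM
  have : s * Real.sign (f (dropCoord i M) - M i) = -1 := by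
    rcases h.sign with hs | hs <;> rw [hs] at hint ⊢
    · rw [Real.sign_of_neg (by linarith)]
      norm_num
    · rw [Real.sign_of_pos (by linarith)]
      norm_num
  rw [this]
  ring

theorem measure_lt_top (h : IsGraphPatch Ω V i s f x₀ ρ α C L) :
    (Measure.euclideanHausdorffMeasure 2 : Measure E3) (frontier Ω ∩ V) < ∞ := by
  rw [h.frontier_inter, euclideanHausdorffMeasure_graphMap_image h.measurable Metric.isOpen_ball
    h.differentiableOn h.continuousOn_fderiv i Metric.isOpen_ball.measurableSet subset_rfl]
  refine setLIntegral_lt_top_of_le_nnreal measure_ball_lt_top.ne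
    ⟨Real.toNNReal √(1 + L ^ 2), fun x hx => ?_⟩
  refine ENNReal.ofReal_le_ofReal (Real.sqrt_le_sqrt ?_)
  have := h.norm_fderiv_le x hx
  gcongr

theorem continuousOn_exteriorNormal (h : IsGraphPatch Ω V i s f x₀ ρ α C L) :
    ContinuousOn (exteriorNormal Ω) (frontier Ω ∩ V) := by
  have hd : ContinuousOn (fun P => fderiv ℝ f (dropCoord i P)) (frontier Ω ∩ V) :=
    h.continuousOn_fderiv.comp (continuous_dropCoord i).continuousOn
      fun P hP => h.dropCoord_mem P hP.2
  have hg : ContinuousOn (graphVector i f) (frontier Ω ∩ V) := by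
    unfold graphVector
    fun_prop
  refine ContinuousOn.congr (ContinuousOn.smul (continuousOn_const.div hg.norm fun P _ => ?_) hg)
    h.normal
  rw [norm_graphVector]
  exact (zero_lt_one.trans_le (one_le_areaElement f _)).ne'

end IsGraphPatch

/-! ### Integrability, and continuity away from the integration set -/

theorem exists_abs_le_of_continuousOn_frontier {Ω : Set E3} (hb : Bornology.IsBounded Ω) {w : E3 → ℝ}
    (hw : ContinuousOn w (frontier Ω)) : ∃ B : ℝ, 0 ≤ B ∧ ∀ P ∈ frontier Ω, |w P| ≤ B := by
  have hcomp : IsCompact (frontier Ω) :=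
    hb.isCompact_closure.of_isClosed_subset isClosed_frontier frontier_subset_closure
  obtain ⟨B, hB⟩ := hcomp.exists_bound_of_continuousOn hw
  exact ⟨max B 0, le_max_right _ _, fun P hP => (hB P hP).trans (le_max_left _ _)⟩

namespace HasC1HolderBoundary

variable {Ω : Set E3} {α : ℝ}

/-- The normal is defined by choice, so its regularity has to be read off from the patches; the
measurability of the kernel rests on this. -/
theorem continuousOn_exteriorNormal (hα : 0 < α) (hΩ : HasC1HolderBoundary Ω α) :
    ContinuousOn (exteriorNormal Ω) (frontier Ω) := by
  intro P hP
  obtain ⟨V, i, s, f, ρ, C, L, h, hg⟩ := hΩ.exists_isGraphPatch hα hP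
  have hPV : P ∈ V := hg ▸ h.center_mem
  have := h.continuousOn_exteriorNormal P ⟨hP, hPV⟩
  exact (continuousWithinAt_inter (h.isOpen.mem_nhds hPV)).1 this

theorem measure_frontier_lt_top (hα : 0 < α) (hΩ : HasC1HolderBoundary Ω α)
    (hb : Bornology.IsBounded Ω) :
    (Measure.euclideanHausdorffMeasure 2 : Measure E3) (frontier Ω) < ∞ := by
  have hcomp : IsCompact (frontier Ω) :=
    hb.isCompact_closure.of_isClosed_subset isClosed_frontier frontier_subset_closure
  refine hcomp.measure_lt_top_of_nhdsWithin fun P hP => ?_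
  obtain ⟨V, i, s, f, ρ, C, L, h, hg⟩ := hΩ.exists_isGraphPatch hα hP
  have hPV : P ∈ V := hg ▸ h.center_mem
  exact ⟨frontier Ω ∩ V, inter_mem_nhdsWithin _ (h.isOpen.mem_nhds hPV), h.measure_lt_top⟩

theorem aestronglyMeasurable_mul_doubleLayerKernel (hα : 0 < α) (hΩ : HasC1HolderBoundary Ω α)
    {w : E3 → ℝ} (hw : ContinuousOn w (frontier Ω)) (M : E3) :
    AEStronglyMeasurable (fun P => w P * doubleLayerKernel Ω M P)
      ((Measure.euclideanHausdorffMeasure 2 : Measure E3).restrict (frontier Ω)) := by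
  -- Away from `M` the integrand is continuous, and the single point `M` carries no area.
  have hae : (frontier Ω \ {M} : Set E3) =ᵐ[(Measure.euclideanHausdorffMeasure 2 : Measure E3)]
      frontier Ω := sdiff_null_ae_eq_self (measure_singleton M)
  rw [← Measure.restrict_congr_set hae]
  refine ContinuousOn.aestronglyMeasurable ?_
    (isClosed_frontier.measurableSet.diff (measurableSet_singleton M))
  have hn := (hΩ.continuousOn_exteriorNormal hα).mono (sdiff_subset (t := {M}))
  have hne : ∀ P ∈ frontier Ω \ {M}, P ≠ M := fun P hP => hP.2
  refine (hw.mono sdiff_subset).mul (ContinuousOn.congr (f := fun P =>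
    -inner ℝ (P - M) (exteriorNormal Ω P) / dist P M ^ 3) ?_
    fun P hP => doubleLayerKernel_eq (hne P hP))
  refine ContinuousOn.div ?_ (by fun_prop) fun P hP => pow_ne_zero _ (dist_ne_zero.2 (hne P hP))
  have hsub : ContinuousOn (fun P : E3 => P - M) (frontier Ω \ {M}) := by fun_prop
  exact (hsub.inner hn).neg

theorem integrableOn_of_le_dist (hα : 0 < α) (hΩ : HasC1HolderBoundary Ω α)
    (hb : Bornology.IsBounded Ω) {w : E3 → ℝ} (hw : ContinuousOn w (frontier Ω)) {T : Set E3}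
    (hT : MeasurableSet T) (hTΩ : T ⊆ frontier Ω) {M : E3} {d : ℝ} (hd : 0 < d)
    (hdist : ∀ P ∈ T, d ≤ dist P M) :
    IntegrableOn (fun P => w P * doubleLayerKernel Ω M P) T
      (Measure.euclideanHausdorffMeasure 2) := by
  obtain ⟨B, hB0, hB⟩ := exists_abs_le_of_continuousOn_frontier hb hw
  refine ⟨(hΩ.aestronglyMeasurable_mul_doubleLayerKernel hα hw M).mono_measure
    (Measure.restrict_mono_set _ hTΩ), .restrict_of_bounded (C := B * (1 / d ^ 2))
    ((measure_mono hTΩ).trans_lt (hΩ.measure_frontier_lt_top hα hb))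
    (ae_restrict_of_forall_mem hT fun P hP => ?_)⟩
  rw [norm_mul]
  exact mul_le_mul (hB P (hTΩ hP)) (abs_doubleLayerKernel_le hd (hdist P hP)) (norm_nonneg _) hB0

/-- The contribution to the potential of a part of `∂Ω` is continuous at positive distance from this
part. -/
theorem continuousAt_integral_of_le_dist (hα : 0 < α) (hΩ : HasC1HolderBoundary Ω α)
    (hb : Bornology.IsBounded Ω) {w : E3 → ℝ} (hw : ContinuousOn w (frontier Ω)) {T : Set E3}
    (hT : MeasurableSet T) (hTΩ : T ⊆ frontier Ω) {M₀ : E3} {d : ℝ} (hd : 0 < d)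
    (hdist : ∀ P ∈ T, d ≤ dist P M₀) :
    ContinuousAt (fun M => ∫ P in T, w P * doubleLayerKernel Ω M P
      ∂(Measure.euclideanHausdorffMeasure 2)) M₀ := by
  obtain ⟨B, hB0, hB⟩ := exists_abs_le_of_continuousOn_frontier hb hw
  have hd2 : 0 < d / 2 := by positivity
  have hnear : ∀ M ∈ Metric.ball M₀ (d / 2), ∀ P ∈ T, d / 2 ≤ dist P M := by
    intro M hM P hP
    have := dist_triangle P M M₀
    have := hdist P hP
    rw [Metric.mem_ball] at hM
    linarith
  refine continuousAt_of_dominated (bound := fun _ => B * (1 / (d / 2) ^ 2))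
    (Eventually.of_forall fun M => (hΩ.aestronglyMeasurable_mul_doubleLayerKernel hα hw
      M).mono_measure (Measure.restrict_mono_set _ hTΩ)) ?_
    (integrableOn_const ((measure_mono hTΩ).trans_lt (hΩ.measure_frontier_lt_top hα hb)).ne) ?_
  · filter_upwards [Metric.ball_mem_nhds M₀ hd2] with M hM
    refine ae_restrict_of_forall_mem hT fun P hP => ?_
    rw [norm_mul]
    exact mul_le_mul (hB P (hTΩ hP)) (abs_doubleLayerKernel_le hd2 (hnear M hM P hP))
      (norm_nonneg _) hB0
  · refine ae_restrict_of_forall_mem hT fun P hP => ContinuousAt.mul continuousAt_const ?_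
    have heq : (fun M => doubleLayerKernel Ω M P) =ᶠ[𝓝 M₀] fun M =>
        -inner ℝ (P - M) (exteriorNormal Ω P) / dist P M ^ 3 := by
      filter_upwards [Metric.ball_mem_nhds M₀ hd2] with M hM
      exact doubleLayerKernel_eq (dist_pos.1 (hd2.trans_le (hnear M hM P hP)))
    refine ContinuousAt.congr ?_ heq.symm
    have hne : dist P M₀ ^ 3 ≠ 0 := pow_ne_zero _ (hd.trans_le (hdist P hP)).ne'
    exact ContinuousAt.div (by fun_prop) (by fun_prop) hne

end HasC1HolderBoundary

theorem exists_le_dist_of_isOpen {V : Set E3} {P₀ : E3} (hV : IsOpen V) (hP₀ : P₀ ∈ V) (S : Set E3) :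
    ∃ d : ℝ, 0 < d ∧ ∀ P ∈ S \ V, d ≤ dist P P₀ := by
  obtain ⟨d, hd, hball⟩ := Metric.isOpen_iff.1 hV P₀ hP₀
  exact ⟨d, hd, fun P hP => not_lt.1 fun h => hP.2 (hball h)⟩

namespace HasC1HolderBoundary

variable {Ω : Set E3} {α : ℝ}

theorem integrableOn_mul_of_integrableOn (hb : Bornology.IsBounded Ω)
    (hα : 0 < α) (hΩ : HasC1HolderBoundary Ω α) {w : E3 → ℝ} (hw : ContinuousOn w (frontier Ω))
    {T : Set E3} (hT : MeasurableSet T) (hTΩ : T ⊆ frontier Ω) {M : E3}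
    (hi : IntegrableOn (doubleLayerKernel Ω M) T (Measure.euclideanHausdorffMeasure 2)) :
    IntegrableOn (fun P => w P * doubleLayerKernel Ω M P) T
      (Measure.euclideanHausdorffMeasure 2) := by
  obtain ⟨B, hB0, hB⟩ := exists_abs_le_of_continuousOn_frontier hb hw
  refine Integrable.mono' (hi.abs.const_mul B)
    ((hΩ.aestronglyMeasurable_mul_doubleLayerKernel hα hw M).mono_measure
      (Measure.restrict_mono_set _ hTΩ)) (ae_restrict_of_forall_mem hT fun P hP => ?_)
  rw [norm_mul]
  exact mul_le_mul_of_nonneg_right (hB P (hTΩ hP)) (norm_nonneg _)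

/-- For `M` on the boundary, the patch around `M` is covered by the weakly singular estimate;
elsewhere the kernel is bounded and the area finite. -/
theorem integrableOn_frontier (hα : 0 < α) (hΩ : HasC1HolderBoundary Ω α)
    (hb : Bornology.IsBounded Ω) {w : E3 → ℝ} (hw : ContinuousOn w (frontier Ω)) (M : E3) :
    IntegrableOn (fun P => w P * doubleLayerKernel Ω M P) (frontier Ω)
      (Measure.euclideanHausdorffMeasure 2) := by
  have hS : MeasurableSet (frontier Ω) := isClosed_frontier.measurableSet
  by_cases hM : M ∈ frontier Ω
  · obtain ⟨V, i, s, f, ρ, C, L, h, hg⟩ := hΩ.exists_isGraphPatch hα hM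
    have hMV : M ∈ V := hg ▸ h.center_mem
    obtain ⟨B, hB⟩ := h.exists_integral_abs_doubleLayerKernel_le
    obtain ⟨d, hd, hdist⟩ := exists_le_dist_of_isOpen h.isOpen hMV (frontier Ω)
    have hVm := h.isOpen.measurableSet
    rw [← inter_union_sdiff (frontier Ω) V]
    exact (hΩ.integrableOn_mul_of_integrableOn hb hα hw (hS.inter hVm) inter_subset_left
      (hB M hMV).1).union (hΩ.integrableOn_of_le_dist hα hb hw (hS.diff hVm) sdiff_subset hd hdist)
  · obtain ⟨d, hd, hdist⟩ := exists_le_dist_of_isOpen isClosed_frontier.isOpen_compl hM (frontier Ω)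
    refine hΩ.integrableOn_of_le_dist hα hb hw hS subset_rfl hd fun P hP => ?_
    exact hdist P ⟨hP, not_not_intro hP⟩

/-- A density which vanishes at a point of `∂Ω` produces no jump there. -/
theorem continuousAt_integral_of_eq_zero (hα : 0 < α) (hΩ : HasC1HolderBoundary Ω α)
    (hb : Bornology.IsBounded Ω) {w : E3 → ℝ} (hw : ContinuousOn w (frontier Ω))
    {V : Set E3} (hV : IsOpen V) {P₀ : E3} (hP₀ : P₀ ∈ frontier Ω) (hP₀V : P₀ ∈ V) (hw0 : w P₀ = 0)
    {B : ℝ} (hB : ∀ M ∈ V,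
      IntegrableOn (doubleLayerKernel Ω M) (frontier Ω ∩ V) (Measure.euclideanHausdorffMeasure 2) ∧
      ∫ P in frontier Ω ∩ V, |doubleLayerKernel Ω M P| ∂(Measure.euclideanHausdorffMeasure 2)
        ≤ B) :
    ContinuousAt (fun M => ∫ P in frontier Ω ∩ V, w P * doubleLayerKernel Ω M P
      ∂(Measure.euclideanHausdorffMeasure 2)) P₀ := by
  have hS : MeasurableSet (frontier Ω) := isClosed_frontier.measurableSet
  have hB0 : 0 ≤ B := (integral_nonneg fun P => abs_nonneg _).trans (hB P₀ hP₀V).2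
  refine continuousAt_of_locally_uniform_approx_of_continuousAt fun u hu => ?_
  obtain ⟨ε, hε, hεu⟩ := Metric.mem_uniformity_dist.1 hu
  -- With `|w| < η` near `P₀`, that part contributes at most `η * B < ε`; the `+ 1` allows `B = 0`.
  set η := ε / (B + 1) with hη
  have hηpos : 0 < η := by positivity
  have hev : ∀ᶠ P in 𝓝[frontier Ω] P₀, |w P| < η := by
    have := (hw P₀ hP₀).tendsto.eventually (Metric.ball_mem_nhds _ hηpos)
    simpa [hw0, Real.norm_eq_abs] using this
  obtain ⟨W, hW, hWo, hP₀W⟩ := eventually_nhds_iff.1 (eventually_nhdsWithin_iff.1 hev)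
  obtain ⟨d, hd, hdist⟩ := exists_le_dist_of_isOpen hWo hP₀W (frontier Ω ∩ V)
  have hT : MeasurableSet (frontier Ω ∩ V) := hS.inter hV.measurableSet
  -- The approximant omits the part of the patch in `W`. It is continuous at `P₀`, and the omitted
  -- piece is below `ε` for every pole in `V`.
  refine ⟨V, hV.mem_nhds hP₀V, fun M => ∫ P in (frontier Ω ∩ V) \ W, w P * doubleLayerKernel Ω M P
      ∂(Measure.euclideanHausdorffMeasure 2),
    hΩ.continuousAt_integral_of_le_dist hα hb hw (hT.diff hWo.measurableSet)
      (sdiff_subset.trans inter_subset_left) hd hdist, fun M hM => hεu ?_⟩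
  obtain ⟨hi, hle⟩ := hB M hM
  have hTW : MeasurableSet (frontier Ω ∩ V ∩ W) := hT.inter hWo.measurableSet
  have hwi := hΩ.integrableOn_mul_of_integrableOn hb hα hw hT inter_subset_left hi
  rw [← integral_inter_add_sdiff hWo.measurableSet hwi, dist_eq_norm, add_sub_cancel_right]
  calc ‖∫ P in frontier Ω ∩ V ∩ W, w P * doubleLayerKernel Ω M P
        ∂(Measure.euclideanHausdorffMeasure 2)‖
      ≤ ∫ P in frontier Ω ∩ V ∩ W, η * |doubleLayerKernel Ω M P|
        ∂(Measure.euclideanHausdorffMeasure 2) := by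
        refine norm_integral_le_of_norm_le ((hi.mono_set inter_subset_left).abs.const_mul η)
          (ae_restrict_of_forall_mem hTW fun P hP => ?_)
        rw [norm_mul]
        exact mul_le_mul_of_nonneg_right (hW P hP.2 hP.1.1).le (norm_nonneg _)
    _ = η * ∫ P in frontier Ω ∩ V ∩ W, |doubleLayerKernel Ω M P|
        ∂(Measure.euclideanHausdorffMeasure 2) := integral_const_mul _ _
    _ ≤ η * ∫ P in frontier Ω ∩ V, |doubleLayerKernel Ω M P|
        ∂(Measure.euclideanHausdorffMeasure 2) := by
        refine mul_le_mul_of_nonneg_left (setIntegral_mono_set hi.abs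
          (ae_of_all _ fun P => abs_nonneg _) (ae_of_all _ fun P hP => ?_)) hηpos.le
        exact hP.1
    _ ≤ η * B := by gcongr
    _ < ε := by
        rw [hη, div_mul_eq_mul_div, div_lt_iff₀ (by positivity)]
        nlinarith

/-- Near a point of `∂Ω`, the potential is the sum of a continuous function and a multiple of the
potential of a constant density on a patch of the boundary. -/
theorem continuousAt_doubleLayerPotential_sub (hα : 0 < α) (hΩ : HasC1HolderBoundary Ω α)
    (hb : Bornology.IsBounded Ω) {v : E3 → ℝ} (hv : ContinuousOn v (frontier Ω))
    {V : Set E3} (hV : IsOpen V) {P₀ : E3} (hP₀ : P₀ ∈ frontier Ω) (hP₀V : P₀ ∈ V)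
    {B : ℝ} (hB : ∀ M ∈ V,
      IntegrableOn (doubleLayerKernel Ω M) (frontier Ω ∩ V) (Measure.euclideanHausdorffMeasure 2) ∧
      ∫ P in frontier Ω ∩ V, |doubleLayerKernel Ω M P| ∂(Measure.euclideanHausdorffMeasure 2)
        ≤ B) :
    ContinuousAt (fun M => doubleLayerPotential Ω v M -
      v P₀ * ∫ P in frontier Ω ∩ V, doubleLayerKernel Ω M P
        ∂(Measure.euclideanHausdorffMeasure 2)) P₀ := by
  have hS : MeasurableSet (frontier Ω) := isClosed_frontier.measurableSet
  obtain ⟨d, hd, hdist⟩ := exists_le_dist_of_isOpen hV hP₀V (frontier Ω)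
  have hw : ContinuousOn (fun P => v P - v P₀) (frontier Ω) := hv.sub continuousOn_const
  have h1 := hΩ.continuousAt_integral_of_le_dist hα hb hv (hS.diff hV.measurableSet) sdiff_subset
    hd hdist
  have h2 := hΩ.continuousAt_integral_of_eq_zero hα hb hw hV hP₀ hP₀V (sub_self _) hB
  -- Here `h2` is the patch with density `v - v P₀` and `h1` the remaining boundary with density
  -- `v`.
  refine (h2.add h1).congr ?_
  filter_upwards [hV.mem_nhds hP₀V] with M hM
  have hi := hΩ.integrableOn_frontier hα hb hv M
  have hsplit := integral_inter_add_sdiff hV.measurableSet hi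
  have hnear : ∫ P in frontier Ω ∩ V, (v P - v P₀) * doubleLayerKernel Ω M P
      ∂(Measure.euclideanHausdorffMeasure 2) =
        (∫ P in frontier Ω ∩ V, v P * doubleLayerKernel Ω M P
          ∂(Measure.euclideanHausdorffMeasure 2)) -
        v P₀ * ∫ P in frontier Ω ∩ V, doubleLayerKernel Ω M P
          ∂(Measure.euclideanHausdorffMeasure 2) := by
    rw [← integral_const_mul, ← integral_sub (hi.mono_set inter_subset_left)
      ((hB M hM).1.const_mul _)]
    simp only [sub_mul]
  simp only [Pi.add_apply]
  rw [hnear, doubleLayerPotential, surfaceMeasure, ← hsplit]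
  ring

end HasC1HolderBoundary

/-! ### The jump relations -/

theorem corollary2p1 (Ω : Set E3) (hΩ_open : IsOpen Ω) (hΩ_conn : IsConnected Ω)
    (hΩ_bdd : Bornology.IsBounded Ω) (α : ℝ) (hα_pos : 0 < α) (hα_le : α ≤ 1)
    (hΩ : HasC1HolderBoundary Ω α) (v : E3 → ℝ) (hv : ContinuousOn v (frontier Ω)) :
    (∀ M : E3, Integrable (fun P => v P * doubleLayerKernel Ω M P) (surfaceMeasure Ω)) ∧
    ContinuousOn (doubleLayerPotential Ω v) (frontier Ω)ᶜ ∧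
    ∀ P₀ ∈ frontier Ω,
      Tendsto (doubleLayerPotential Ω v) (𝓝[Ω] P₀)
        (𝓝 (doubleLayerPotential Ω v P₀ - 2 * Real.pi * v P₀)) ∧
      Tendsto (doubleLayerPotential Ω v) (𝓝[(closure Ω)ᶜ] P₀)
        (𝓝 (doubleLayerPotential Ω v P₀ + 2 * Real.pi * v P₀)) := by
  refine ⟨fun M => hΩ.integrableOn_frontier hα_pos hΩ_bdd hv M, fun M hM => ?_, fun P₀ hP₀ => ?_⟩
  · obtain ⟨d, hd, hdist⟩ := exists_le_dist_of_isOpen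
      isClosed_frontier.isOpen_compl hM (frontier Ω)
    exact (hΩ.continuousAt_integral_of_le_dist hα_pos hΩ_bdd hv isClosed_frontier.measurableSet
      subset_rfl hd fun P hP => hdist P ⟨hP, not_not_intro hP⟩).continuousWithinAt
  · obtain ⟨V, i, s, f, ρ, C, L, h, hg⟩ := hΩ.exists_isGraphPatch hα_pos hP₀
    have hP₀V : P₀ ∈ V := hg ▸ h.center_mem
    obtain ⟨B, hB⟩ := h.exists_integral_abs_doubleLayerKernel_le
    have hcont := hΩ.continuousAt_doubleLayerPotential_sub hα_pos hΩ_bdd hv h.isOpen hP₀ hP₀V hB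
    have hin := h.tendsto_integral_doubleLayerKernel_inside
    have hout := h.tendsto_integral_doubleLayerKernel_outside
    rw [hg] at hin hout
    constructor
    -- Adding back `v P₀` times the patch integral restores the potential; the patch integrals at
    -- `P₀` cancel in the limit, leaving only the jump.
    · have := (hcont.tendsto.mono_left nhdsWithin_le_nhds).add (hin.const_mul (v P₀))
      refine (this.congr fun M => ?_).trans_eq ?_
      · ring
      · congr 1
        ring
    · have := (hcont.tendsto.mono_left nhdsWithin_le_nhds).add (hout.const_mul (v P₀))
      refine (this.congr fun M => ?_).trans_eq ?_
      · ring
      · congr 1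
        ring
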